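/- Let $q$ be a power of a prime $p$, $n\ge 1$ an integer with $\gcd(n,q)=1$, and $t\ge 2$ an integer. Let $\mathcal R^{(q)}=\mathbb F_q[X]/\langle X^n-1\rangle\subseteq \mathcal R=\mathbb F_{q^t}[X]/\langle X^n-1\rangle$, and identify $a=(a_0,\dots,a_{n-1})\in\mathbb F_{q^t}^n$ with $a(X)=\sum_j a_jX^j\in\mathcal R$. For $u\ge 0$ and $v$ coprime to $n$ let $\tau_{q^u,v}(\sum_j a_jX^j)=\sum_j a_j^{q^u}X^{vj}$ on $\mathcal R$ (and likewise on $\mathcal R^{(q)}$), and let $\mathrm{Tr}:\mathbb F_{q^t}\to\mathbb F_q$ be the trace. Let $\delta\in\{\ast,0,\gamma\}$, where $t\not\equiv 1 \pmod p$ if $\delta=\ast$, and $t=2^am$ with $a\ge 1$ and $m$ odd if $\delta=\gamma$; in the latter case $\gamma\ne 0$ is an element of $\mathbb F_{q^{2^a}}\subseteq\mathbb F_{q^t}$ with $\gamma+\gamma^{q^{2^{a-1}}}=0$. On $\mathbb F_{q^t}^n$ put $$(a,b)_\ast=\sum_j\mathrm{Tr}\Big(a_j\sum_{w=1}^{t-1}b_j^{q^w}\Big),\quad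 (a,b)_0=\sum_j\mathrm{Tr}(a_jb_j),\quad (a,b)_\gamma=\sum_j\mathrm{Tr}(\gamma a_jb_j^{q^{t/2}}),$$ and on $\mathcal R$ put $$[a,b]_\ast=\sum_{u=0}^{t-1}\tau_{q^u,1}\Big(a\sum_{w=1}^{t-1}\tau_{q^w,-1}(b)\Big),\quad [a,b]_0=\sum_{w=0}^{t-1}\tau_{q^w,1}(a\,\tau_{1,-1}(b)),\quad [a,b]_\gamma=\sum_{w=0}^{t-1}\tau_{q^w,1}(\gamma a\,\tau_{q^{t/2},-1}(b)).$$ For a code $\mathcal C\subseteq\mathbb F_{q^t}^n$ let $\mathcal C^{\perp_\delta}=\{v:(v,c)_\delta=0\text{ for all }c\in\mathcal C\}$. Let $\eta$ be a primitive $n$-th root of unity in an extension field of $\mathbb F_{q^t}$. For $\ell_i\in\mathbb Z/n$ let $C_{\ell_i}=\{\ell_iq^j: j\ge 0\}$ be its $q$-cyclotomic coset, $d_i=|C_{\ell_i}|$ and $f_i=\prod_{k\in C_{\ell_i}}(X-\eta^k)\in\mathbb F_q[X]$. Let $\mathcal K_i$ be the ideal of $\mathcal R^{(q)}$ generated by $(X^n-1)/f_i$.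 With $g_i=\gcd(d_i,t)$, let $\mathcal J_i=\bigoplus_{j=0}^{g_i-1}\mathcal I_{i,j}$, where $\mathcal I_{i,j}$ is the ideal of $\mathcal R$ generated by $(X^n-1)/M_{i,j}$ and $M_{i,j}$ is the minimal polynomial of $\eta^{\ell_iq^j}$ over $\mathbb F_{q^t}$. Under multiplication $\mathcal K_i$ is a field, with identity the idempotent generator of the ideal, and $\mathcal J_i$ is a vector space over it. Assume that $C_{-\ell_i}=C_{\ell_i}$, that $C_{\ell_i}\ne C_0$, and, if $n$ is even, that $C_{\ell_i}\neq C_{n/2}$. Then: 1. $d_i$ is even, $\mathcal K_i$ has $q^{d_i}$ elements, and $\dim_{\mathcal K_i}\mathcal J_i=t$. 2. $\tau_{1,-1}$ restricts to an automorphism $\sigma$ of $\mathcal K_i$ of order $2$, and $[\cdot,\cdot]_\delta$ restricts to a form $\mathcal J_i\times\mathcal J_i\to\mathcal K_i$ that is linear in the first and $\sigma$-semilinear in the second argument. Some multiple of this form by a nonzero $v\in\mathcal K_i$ is unitary, that is, Hermitian with respect to $\sigma$ and non-degenerate; for $\delta\in\{\ast,0\}$ the form itself is unitary. 3. For a $\mathcal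 K_i$-subspace $\mathcal C_i$ of $\mathcal J_i$ let $\mathcal C_i^{(\delta)}=\{a\in\mathcal J_i:[a,c]_\delta=0\text{ for all }c\in\mathcal C_i\}$. If $\mathcal C\subseteq\mathbb F_{q^t}^n$ is a cyclic $\mathbb F_q$-linear code and $\mathcal C_i=\mathcal C\cap\mathcal J_i$, then $\mathcal C^{\perp_\delta}\cap\mathcal J_i=\mathcal C_i^{(\delta)}$. 4. The number of $\mathcal K_i$-subspaces $\mathcal C_i$ of $\mathcal J_i$ with $\mathcal C_i\cap\mathcal C_i^{(\delta)}=\{0\}$ is $$2+\sum_{k=1}^{t-1}q^{k(t-k)d_i/2}\prod_{j=0}^{k-1}\frac{q^{(t-j)d_i/2}-(-1)^{t-j}}{q^{(k-j)d_i/2}-(-1)^{k-j}}.$$ -/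

import Mathlib

open Polynomial Module

noncomputable section

namespace CyclicCode

/-! ### Cyclotomic cosets -/

open Classical in
/-- The `q`-cyclotomic coset `{ℓ, ℓ q, ℓ q², …}` modulo `n`. -/
def coset {n : ℕ} [NeZero n] (q : ℕ) (ℓ : ZMod n) : Finset (ZMod n) :=
  Finset.univ.filter fun k => ∃ j : ℕ, k = ℓ * (q : ZMod n) ^ j

/-- The representatives `ℓ` of the `q`-cyclotomic cosets modulo `n` that are fixed by the
permutation `C_ℓ ↦ C_{-ℓ}`, other than the coset of `0` and (for even `n`) the coset of `n / 2`. -/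
def fixedReps (n : ℕ) [NeZero n] (q : ℕ) : Set (ZMod n) :=
  {ℓ | coset q (-ℓ) = coset q ℓ ∧ coset q ℓ ≠ coset q 0 ∧
    (Even n → coset q ℓ ≠ coset q ((n / 2 : ℕ) : ZMod n))}

/-! ### The rings and their automorphisms -/

/-- The ring `k[X] / ⟨X ^ n - 1⟩`. -/
abbrev Rn (k : Type*) [Field k] (n : ℕ) : Type _ := AdjoinRoot (X ^ n - 1 : k[X])

theorem root_pow (k : Type*) [Field k] (n : ℕ) :
    (AdjoinRoot.root (X ^ n - 1 : k[X])) ^ n = 1 := by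
  have h := AdjoinRoot.eval₂_root (X ^ n - 1 : k[X])
  simpa [sub_eq_zero] using h

/-- The inclusion `F[X] / ⟨X ^ n - 1⟩ → E[X] / ⟨X ^ n - 1⟩` for an extension `E` of `F`. -/
def incl (F E : Type*) [Field F] [Field E] [Algebra F E] (n : ℕ) : Rn F n →+* Rn E n :=
  AdjoinRoot.map (algebraMap F E) (X ^ n - 1) (X ^ n - 1) (by simp)

/-- For an extension `E` of `F = 𝔽_q`, the ring endomorphism
`∑ a_i X ^ i ↦ ∑ a_i ^ (q ^ u) X ^ (v i)` of `E[X] / ⟨X ^ n - 1⟩`. -/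
def tau (F : Type*) {E : Type*} [Field F] [Fintype F] [Field E] [Algebra F E] {n : ℕ}
    (u : ℕ) (v : (ZMod n)ˣ) : Rn E n →+* Rn E n :=
  AdjoinRoot.lift
    ((AdjoinRoot.of (X ^ n - 1 : E[X])).comp ((FiniteField.frobeniusAlgHom F E ^ u : E →ₐ[F] E) :
      E →+* E))
    (AdjoinRoot.root (X ^ n - 1 : E[X]) ^ (v : ZMod n).val)
    (by simp [pow_right_comm, root_pow])

/-- The identification of a vector `(a_0, …, a_{n-1})` with the class of `∑ a_j X ^ j`. -/
def toRn {E : Type*} [Field E] {n : ℕ} (a : Fin n → E) : Rn E n :=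
  AdjoinRoot.mk _ (∑ j : Fin n, C (a j) * X ^ (j : ℕ))

theorem tau_toRn (F : Type*) {E : Type*} [Field F] [Fintype F] [Field E] [Algebra F E] {n : ℕ}
    (u : ℕ) (v : (ZMod n)ˣ) (a : Fin n → E) :
    tau F u v (toRn a) = AdjoinRoot.mk _
      (∑ j : Fin n, C (a j ^ Fintype.card F ^ u) * X ^ ((v : ZMod n).val * (j : ℕ))) := by
  have h : ∀ x : E, (FiniteField.frobeniusAlgHom F E ^ u : E →ₐ[F] E) x
      = x ^ Fintype.card F ^ u := by
    intro x
    rw [AlgHom.coe_pow, FiniteField.coe_frobeniusAlgHom, pow_iterate]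
  rw [tau, toRn, AdjoinRoot.lift_mk, eval₂_finsetSum, map_sum]
  refine Finset.sum_congr rfl fun j _ => ?_
  rw [eval₂_mul, eval₂_C, eval₂_X_pow, RingHom.comp_apply, RingHom.coe_coe, h, pow_mul, map_mul,
    map_pow _ (X ^ _), map_pow _ X, AdjoinRoot.mk_C, AdjoinRoot.mk_X]

/-! ### Minimal ideals -/

/-- The irreducible factor of `X ^ n - 1` over `k` that belongs to the coset of `ℓ`; see
`map_cosetPoly` for its factorization `∏ (X - η ^ m)`. -/
def cosetPoly (k : Type*) {L : Type*} [Field k] [Field L] [Algebra k L] {n : ℕ}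
    (η : L) (ℓ : ZMod n) : k[X] :=
  minpoly k (η ^ ℓ.val)

theorem pow_val_mul {L : Type*} [Field L] {n : ℕ} [NeZero n] {η : L} (hη : IsPrimitiveRoot η n)
    (a : ZMod n) (m : ℕ) : η ^ (a * (m : ZMod n)).val = (η ^ a.val) ^ m := by
  have : (a * (m : ZMod n)).val ≡ a.val * m [MOD n] := by
    rw [← ZMod.natCast_eq_natCast_iff]
    simp
  rw [← pow_mul, (hη.isOfFinOrder (NeZero.ne n)).pow_eq_pow_iff_modEq, ← hη.eq_orderOf]
  exact this

theorem mem_range_of_pow_card {k L : Type*} [Field k] [Fintype k] [Field L] [Algebra k L]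
    {x : L} (hx : x ^ Fintype.card k = x) : x ∈ Set.range (algebraMap k L) := by
  classical
  have hne : (X ^ Fintype.card k - X : L[X]) ≠ 0 :=
    FiniteField.X_pow_card_sub_X_ne_zero L Fintype.one_lt_card
  have hsub : Finset.univ.image (algebraMap k L) ⊆ (X ^ Fintype.card k - X : L[X]).roots.toFinset := by
    intro y hy
    obtain ⟨a, -, rfl⟩ := Finset.mem_image.1 hy
    rw [Multiset.mem_toFinset, mem_roots hne]
    simp [IsRoot, ← map_pow, FiniteField.pow_card]
  have hcard : (X ^ Fintype.card k - X : L[X]).roots.toFinset.card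
      ≤ (Finset.univ.image (algebraMap k L)).card := by
    rw [Finset.card_image_of_injective _ (algebraMap k L).injective, Finset.card_univ]
    refine (Multiset.toFinset_card_le _).trans ((card_roots' _).trans ?_)
    rw [FiniteField.X_pow_card_sub_X_natDegree_eq L Fintype.one_lt_card]
  have hmem : x ∈ (X ^ Fintype.card k - X : L[X]).roots.toFinset := by
    rw [Multiset.mem_toFinset, mem_roots hne]
    simp [IsRoot, hx]
  rw [← Finset.eq_of_subset_of_card_le hsub hcard] at hmem
  obtain ⟨a, -, rfl⟩ := Finset.mem_image.1 hmem
  exact ⟨a, rfl⟩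

theorem isIntegral_eta (k : Type*) {L : Type*} [Field k] [Field L] [Algebra k L] {n : ℕ}
    [NeZero n] {η : L} (hη : IsPrimitiveRoot η n) (m : ℕ) : IsIntegral k (η ^ m) :=
  (IsIntegral.of_pow (NeZero.pos n) (by rw [hη.pow_eq_one]; exact isIntegral_one)).pow m

theorem map_cosetPoly (k : Type*) {L : Type*} [Field k] [Fintype k] [Field L] [Algebra k L]
    {n : ℕ} [NeZero n] {η : L} (hη : IsPrimitiveRoot η n) (ℓ : ZMod n) :
    (cosetPoly k η ℓ).map (algebraMap k L)
      = ∏ m ∈ coset (Fintype.card k) ℓ, (X - C (η ^ m.val)) := by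
  classical
  set q := Fintype.card k with hq
  set P : L[X] := ∏ m ∈ coset q ℓ, (X - C (η ^ m.val)) with hP
  have hinj : ∀ a b : ZMod n, η ^ a.val = η ^ b.val → a = b := fun a b h =>
    ZMod.val_injective n (hη.pow_inj (ZMod.val_lt a) (ZMod.val_lt b) h)
  let φ : L →ₐ[k] L := FiniteField.frobeniusAlgHom k L
  have hφ : ∀ x : L, φ x = x ^ q := fun x => rfl
  have hφinj : Function.Injective φ := φ.toRingHom.injective
  have hmaps : ∀ m ∈ coset q ℓ, m * (q : ZMod n) ∈ coset q ℓ := by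
    intro m hm
    simp only [coset, Finset.mem_filter, Finset.mem_univ, true_and] at hm ⊢
    obtain ⟨j, rfl⟩ := hm
    exact ⟨j + 1, by ring⟩
  have hinjOn : Set.InjOn (fun m : ZMod n => m * (q : ZMod n)) (coset q ℓ) := by
    intro a _ b _ hab
    apply hinj
    apply hφinj
    rw [hφ, hφ, ← pow_val_mul hη, ← pow_val_mul hη]
    exact congrArg (fun z : ZMod n => η ^ z.val) hab
  have hPφ : P.map (φ : L →+* L) = P := by
    rw [hP, Polynomial.map_prod]
    refine Finset.prod_nbij (fun m => m * (q : ZMod n)) hmaps hinjOn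
      (Finset.surjOn_of_injOn_of_card_le _ hmaps hinjOn le_rfl) ?_
    intro m _
    rw [pow_val_mul hη, ← hφ]
    simp
  have hlift : P ∈ lifts (algebraMap k L) := by
    rw [lifts_iff_coeff_lifts]
    intro i
    apply mem_range_of_pow_card
    have := congrArg (fun p => p.coeff i) hPφ
    simpa [hφ] using this
  obtain ⟨g, hg⟩ := (mem_lifts P).1 hlift
  have hself : ℓ ∈ coset q ℓ := by
    simp only [coset, Finset.mem_filter, Finset.mem_univ, true_and]
    exact ⟨0, by simp⟩
  have hdvd : (cosetPoly k η ℓ).map (algebraMap k L) ∣ P := by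
    rw [← hg]
    apply Polynomial.map_dvd
    apply minpoly.dvd
    rw [aeval_def, ← eval_map, hg, hP, eval_prod]
    exact Finset.prod_eq_zero hself (by simp)
  have hint : IsIntegral k (η ^ ℓ.val) := isIntegral_eta k hη _
  have hdvd' : P ∣ (cosetPoly k η ℓ).map (algebraMap k L) := by
    apply Finset.prod_dvd_of_coprime
    · intro a _ b _ hab
      exact isCoprime_X_sub_C_of_isUnit_sub
        (sub_ne_zero.2 fun h => hab (hinj a b h)).isUnit
    · intro m hm
      rw [dvd_iff_isRoot, IsRoot, eval_map, ← aeval_def]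
      simp only [coset, Finset.mem_filter, Finset.mem_univ, true_and] at hm
      obtain ⟨j, rfl⟩ := hm
      induction j with
      | zero => simp [cosetPoly]
      | succ j ih =>
        rw [pow_succ, ← mul_assoc, pow_val_mul hη, ← hφ, aeval_algHom_apply, ih, map_zero]
  exact eq_of_monic_of_associated ((minpoly.monic hint).map _)
    (monic_prod_of_monic _ _ fun m _ => monic_X_sub_C _) (associated_of_dvd_dvd hdvd hdvd')

/-- The minimal ideal of `k[X] / ⟨X ^ n - 1⟩` generated by `(X ^ n - 1) / f`, where `f` is the
irreducible factor of `X ^ n - 1` that belongs to the coset of `ℓ`. -/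
def minIdeal (k : Type*) {L : Type*} [Field k] [Field L] [Algebra k L] {n : ℕ}
    (η : L) (ℓ : ZMod n) : Ideal (Rn k n) :=
  Ideal.span {AdjoinRoot.mk _ ((X ^ n - 1) / cosetPoly k η ℓ)}

/-- The ideal `𝒥 = ⨁_{j < g} ℐ_j` of `E[X] / ⟨X ^ n - 1⟩`, where `g = gcd (d, t)` for
`d = |C_ℓ|` and `t = [E : F]`, and `ℐ_j` is the minimal ideal that belongs to the coset
of `ℓ q ^ j`. -/
def JIdeal (F E : Type*) {L : Type*} [Field F] [Fintype F] [Field E] [Algebra F E] [Field L]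
    [Algebra E L] {n : ℕ} [NeZero n] (η : L) (ℓ : ZMod n) : Ideal (Rn E n) :=
  ⨆ j ∈ Finset.range (Nat.gcd (coset (Fintype.card F) ℓ).card (finrank F E)),
    minIdeal E η (ℓ * (Fintype.card F : ZMod n) ^ j)

/-! ### The field `𝒦` and the vector space `𝒥` -/

theorem separable_X_pow_sub_one (k : Type*) {L : Type*} [Field k] [Field L] [Algebra k L]
    {n : ℕ} [NeZero n] {η : L} (hη : IsPrimitiveRoot η n) : (X ^ n - 1 : k[X]).Separable := by
  rw [X_pow_sub_one_separable_iff]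
  intro h
  have := hη.neZero'
  apply this.out
  rw [← map_natCast (algebraMap k L), h, map_zero]

theorem cosetPoly_dvd (k : Type*) {L : Type*} [Field k] [Field L] [Algebra k L]
    {n : ℕ} [NeZero n] {η : L} (hη : IsPrimitiveRoot η n) (ℓ : ZMod n) :
    cosetPoly k η ℓ ∣ X ^ n - 1 := by
  apply minpoly.dvd
  simp [pow_right_comm, hη.pow_eq_one]

/-- The generator `(X ^ n - 1) / f` and `f` are coprime, and their product is `X ^ n - 1`. -/
theorem exists_cofactor (k : Type*) {L : Type*} [Field k] [Field L] [Algebra k L]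
    {n : ℕ} [NeZero n] {η : L} (hη : IsPrimitiveRoot η n) (ℓ : ZMod n) :
    cosetPoly k η ℓ * ((X ^ n - 1) / cosetPoly k η ℓ) = X ^ n - 1 ∧
      IsCoprime (cosetPoly k η ℓ) ((X ^ n - 1) / cosetPoly k η ℓ) := by
  have h0 : cosetPoly k η ℓ ≠ 0 := minpoly.ne_zero (isIntegral_eta k hη _)
  have h := EuclideanDomain.mul_div_cancel' h0 (cosetPoly_dvd k hη ℓ)
  refine ⟨h, ?_⟩
  have hs := separable_X_pow_sub_one k hη
  rw [← h] at hs
  exact hs.isCoprime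

/-- The minimal ideal has an identity element and inverses of its nonzero elements. -/
theorem minIdeal_field (k : Type*) {L : Type*} [Field k] [Field L] [Algebra k L]
    {n : ℕ} [NeZero n] {η : L} (hη : IsPrimitiveRoot η n) (ℓ : ZMod n) :
    ∃ e ∈ minIdeal k η ℓ, e ≠ 0 ∧ (∀ x ∈ minIdeal k η ℓ, e * x = x) ∧
      ∀ x ∈ minIdeal k η ℓ, x ≠ 0 → ∃ y ∈ minIdeal k η ℓ, x * y = e := by
  obtain ⟨h1, h2⟩ := exists_cofactor k hη ℓ
  have hirr : Irreducible (cosetPoly k η ℓ) := minpoly.irreducible (isIntegral_eta k hη _)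
  unfold minIdeal
  set f := cosetPoly k η ℓ
  set g := (X ^ n - 1) / f
  obtain ⟨a, b, hab⟩ := h2
  have hfg : AdjoinRoot.mk (X ^ n - 1 : k[X]) f * AdjoinRoot.mk (X ^ n - 1 : k[X]) g = 0 := by
    rw [← map_mul, h1, AdjoinRoot.mk_self]
  have hab' := congrArg (AdjoinRoot.mk (X ^ n - 1 : k[X])) hab
  rw [map_add, map_mul, map_mul, map_one] at hab'
  have hid : ∀ x ∈ Ideal.span {AdjoinRoot.mk (X ^ n - 1 : k[X]) g},
      AdjoinRoot.mk (X ^ n - 1 : k[X]) b * AdjoinRoot.mk (X ^ n - 1 : k[X]) g * x = x := by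
    intro x hx
    obtain ⟨c, rfl⟩ := Ideal.mem_span_singleton'.1 hx
    linear_combination (c * AdjoinRoot.mk (X ^ n - 1 : k[X]) g) * hab'
      - (AdjoinRoot.mk (X ^ n - 1 : k[X]) a * c) * hfg
  have hmem : ∀ c, c * AdjoinRoot.mk (X ^ n - 1 : k[X]) g
      ∈ Ideal.span {AdjoinRoot.mk (X ^ n - 1 : k[X]) g} := fun c =>
    Ideal.mem_span_singleton'.2 ⟨c, rfl⟩
  have hinv : ∀ x ∈ Ideal.span {AdjoinRoot.mk (X ^ n - 1 : k[X]) g}, x ≠ 0 →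
      ∃ y, x * y = AdjoinRoot.mk (X ^ n - 1 : k[X]) b * AdjoinRoot.mk (X ^ n - 1 : k[X]) g := by
    intro x hx hx0
    obtain ⟨c, rfl⟩ := Ideal.mem_span_singleton'.1 hx
    obtain ⟨h, rfl⟩ := AdjoinRoot.mk_surjective c
    have hnd : ¬ f ∣ h := by
      rintro ⟨r, rfl⟩
      apply hx0
      rw [map_mul]
      linear_combination AdjoinRoot.mk (X ^ n - 1 : k[X]) r * hfg
    obtain ⟨a', b', hab2⟩ := (hirr.coprime_iff_not_dvd.2 hnd)
    have hab3 := congrArg (AdjoinRoot.mk (X ^ n - 1 : k[X])) hab2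
    rw [map_add, map_mul, map_mul, map_one] at hab3
    refine ⟨AdjoinRoot.mk _ b' * AdjoinRoot.mk _ b, ?_⟩
    linear_combination (AdjoinRoot.mk (X ^ n - 1 : k[X]) b * AdjoinRoot.mk (X ^ n - 1 : k[X]) g)
      * hab3 - (AdjoinRoot.mk (X ^ n - 1 : k[X]) a' * AdjoinRoot.mk (X ^ n - 1 : k[X]) b) * hfg
  refine ⟨_, hmem (AdjoinRoot.mk _ b), ?_, hid, ?_⟩
  · intro h0
    have hg0 := hid _ (hmem 1)
    rw [h0, zero_mul, one_mul, eq_comm, AdjoinRoot.mk_eq_zero] at hg0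
    have hne : g ≠ 0 := by
      intro hg
      rw [hg, mul_zero] at h1
      exact X_pow_sub_C_ne_zero (NeZero.pos n) (1 : k) (by simpa using h1.symm)
    rw [← h1] at hg0
    obtain ⟨r, hr⟩ := hg0
    apply hirr.not_isUnit
    refine IsUnit.of_mul_eq_one r ?_
    apply mul_right_cancel₀ hne
    rw [one_mul]
    linear_combination -hr
  · intro x hx hx0
    obtain ⟨y, hy⟩ := hinv x hx hx0
    refine ⟨AdjoinRoot.mk _ b * AdjoinRoot.mk _ g * y, ?_, ?_⟩
    · rw [mul_right_comm]; exact hmem _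
    · calc _ = AdjoinRoot.mk _ b * AdjoinRoot.mk _ g * (x * y) := by ring
        _ = _ := by rw [hy]; exact hid _ (hmem _)

/-- The minimal ideal `𝒦` of `F[X] / ⟨X ^ n - 1⟩` as a type, with the operations of the ring.
It is a field, whose identity is the idempotent generator of the ideal. -/
def KField (F : Type*) {L : Type*} [Field F] [Field L] [Algebra F L] {n : ℕ} [NeZero n]
    {η : L} (_hη : IsPrimitiveRoot η n) (ℓ : ZMod n) : Type _ :=
  ↥(minIdeal F η ℓ)

section KField

variable (F : Type*) {L : Type*} [Field F] [Field L] [Algebra F L] {n : ℕ} [NeZero n]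
  {η : L} (hη : IsPrimitiveRoot η n) (ℓ : ZMod n)

instance : AddCommGroup (KField F hη ℓ) :=
  inferInstanceAs (AddCommGroup ↥(minIdeal F η ℓ))

/-- The underlying element of `F[X] / ⟨X ^ n - 1⟩`. -/
def KField.val {F : Type*} {L : Type*} [Field F] [Field L] [Algebra F L] {n : ℕ} [NeZero n]
    {η : L} {hη : IsPrimitiveRoot η n} {ℓ : ZMod n} (x : KField F hη ℓ) : Rn F n :=
  Subtype.val (p := fun y => y ∈ minIdeal F η ℓ) x

/-- The identity of `𝒦`. -/
def KField.e : KField F hη ℓ :=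
  ⟨(minIdeal_field F hη ℓ).choose, (minIdeal_field F hη ℓ).choose_spec.1⟩

theorem KField.exists_inv (x : KField F hη ℓ) (hx : x ≠ 0) :
    ∃ y : KField F hη ℓ, x.val * y.val = (KField.e F hη ℓ).val := by
  obtain ⟨y, hy, h⟩ := (minIdeal_field F hη ℓ).choose_spec.2.2.2 x.val x.2
    (fun h0 => hx (Subtype.ext h0))
  exact ⟨⟨y, hy⟩, h⟩

open Classical in
instance : Field (KField F hη ℓ) :=
  { (inferInstance : AddCommGroup (KField F hη ℓ)) with
    mul := fun x y => ⟨x.val * y.val, Ideal.mul_mem_left _ _ y.2⟩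
    one := KField.e F hη ℓ
    inv := fun x => if h : x = 0 then 0 else (KField.exists_inv F hη ℓ x h).choose
    mul_assoc := fun x y z => Subtype.ext (mul_assoc x.val y.val z.val)
    mul_comm := fun x y => Subtype.ext (mul_comm x.val y.val)
    left_distrib := fun x y z => Subtype.ext (mul_add x.val y.val z.val)
    right_distrib := fun x y z => Subtype.ext (add_mul x.val y.val z.val)
    zero_mul := fun x => Subtype.ext (zero_mul x.val)
    mul_zero := fun x => Subtype.ext (mul_zero x.val)
    one_mul := fun x => Subtype.ext ((minIdeal_field F hη ℓ).choose_spec.2.2.1 x.1 x.2)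
    mul_one := fun x => Subtype.ext ((mul_comm _ _).trans
      ((minIdeal_field F hη ℓ).choose_spec.2.2.1 x.1 x.2))
    exists_pair_ne := ⟨0, KField.e F hη ℓ, fun h =>
      (minIdeal_field F hη ℓ).choose_spec.2.1 (congrArg KField.val h.symm)⟩
    inv_zero := dif_pos rfl
    mul_inv_cancel := fun x h => by
      refine Subtype.ext (Eq.trans ?_ (KField.exists_inv F hη ℓ x h).choose_spec)
      exact congrArg (fun y : KField F hη ℓ => x.val * y.val) (dif_neg h)
    nnqsmul := _
    qsmul := _ }

@[simp] theorem KField.val_mul (x y : KField F hη ℓ) : (x * y).val = x.val * y.val := rfl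

@[simp] theorem KField.val_add (x y : KField F hη ℓ) : (x + y).val = x.val + y.val := rfl

end KField

/-- The ideal `𝒥` of `E[X] / ⟨X ^ n - 1⟩` as a type; a vector space over `𝒦` through
multiplication in `E[X] / ⟨X ^ n - 1⟩`. -/
def JSpace (F E : Type*) {L : Type*} [Field F] [Fintype F] [Field E] [Algebra F E] [Field L]
    [Algebra F L] [Algebra E L] [IsScalarTower F E L] {n : ℕ} [NeZero n] {η : L}
    (_hη : IsPrimitiveRoot η n) (ℓ : ZMod n) : Type _ :=
  ↥(JIdeal F E η ℓ)

section JSpace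

variable (F E : Type*) {L : Type*} [Field F] [Fintype F] [Field E] [Algebra F E] [Field L]
  [Algebra F L] [Algebra E L] [IsScalarTower F E L] {n : ℕ} [NeZero n] {η : L}
  (hη : IsPrimitiveRoot η n) (ℓ : ZMod n)

instance : AddCommGroup (JSpace F E hη ℓ) :=
  inferInstanceAs (AddCommGroup ↥(JIdeal F E η ℓ))

/-- The underlying element of `E[X] / ⟨X ^ n - 1⟩`. -/
def JSpace.val {F E : Type*} {L : Type*} [Field F] [Fintype F] [Field E] [Algebra F E] [Field L]
    [Algebra F L] [Algebra E L] [IsScalarTower F E L] {n : ℕ} [NeZero n] {η : L}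
    {hη : IsPrimitiveRoot η n} {ℓ : ZMod n} (x : JSpace F E hη ℓ) : Rn E n :=
  Subtype.val (p := fun y => y ∈ JIdeal F E η ℓ) x

/-- The identity of `𝒦` acts as the identity on `𝒥`. -/
theorem e_mul_J (x : Rn E n) (hx : x ∈ JIdeal F E η ℓ) :
    incl F E n (KField.e F hη ℓ).val * x = x := by
  have key : JIdeal F E η ℓ ≤ LinearMap.ker
      (LinearMap.mulLeft (Rn E n) (incl F E n (KField.e F hη ℓ).val - 1)) := by
    refine iSup₂_le fun j _ => ?_
    rw [minIdeal, Ideal.span_le, Set.singleton_subset_iff]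
    set m : ZMod n := ℓ * (Fintype.card F : ZMod n) ^ j with hm
    have hM : cosetPoly E η m ∣ (cosetPoly F η ℓ).map (algebraMap F E) := by
      apply minpoly.dvd
      rw [aeval_def, ← eval_map, Polynomial.map_map, ← IsScalarTower.algebraMap_eq,
        map_cosetPoly F hη, eval_prod]
      refine Finset.prod_eq_zero (i := m) ?_ (by simp)
      simp only [coset, Finset.mem_filter, Finset.mem_univ, true_and]
      exact ⟨j, rfl⟩
    obtain ⟨r, hr⟩ := hM
    have hE := (exists_cofactor E hη m).1
    have hF := congrArg (Polynomial.map (algebraMap F E)) (exists_cofactor F hη ℓ).1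
    rw [Polynomial.map_mul, hr] at hF
    have hne : cosetPoly E η m ≠ 0 := minpoly.ne_zero (isIntegral_eta E hη _)
    have hg : (X ^ n - 1) / cosetPoly E η m
        = r * ((X ^ n - 1) / cosetPoly F η ℓ).map (algebraMap F E) := by
      apply mul_left_cancel₀ hne
      rw [hE, ← mul_assoc, hF]
      simp
    have he := (minIdeal_field F hη ℓ).choose_spec.2.2.1 _
      (Ideal.mem_span_singleton_self (AdjoinRoot.mk _ ((X ^ n - 1) / cosetPoly F η ℓ)))
    have he' := congrArg (incl F E n) he
    have hincl : ∀ p : F[X], incl F E n (AdjoinRoot.mk _ p)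
        = AdjoinRoot.mk _ (p.map (algebraMap F E)) := fun p => by
      rw [incl, AdjoinRoot.map, AdjoinRoot.lift_mk, ← eval₂_map, ← AdjoinRoot.algebraMap_eq,
        ← aeval_def, AdjoinRoot.aeval_eq]
    rw [map_mul, hincl] at he'
    change (incl F E n (KField.e F hη ℓ).val - 1) * AdjoinRoot.mk _ _ = 0
    rw [hg, map_mul, sub_mul, one_mul, sub_eq_zero, mul_left_comm]
    exact congrArg _ he'
  have h := key hx
  rw [LinearMap.mem_ker, LinearMap.mulLeft_apply, sub_mul, one_mul, sub_eq_zero] at h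
  exact h

instance : Module (KField F hη ℓ) (JSpace F E hη ℓ) where
  smul c x := ⟨incl F E n c.val * x.val, Ideal.mul_mem_left _ _ x.2⟩
  one_smul x := Subtype.ext (e_mul_J F E hη ℓ x.val x.2)
  mul_smul c d x := Subtype.ext (by
    change incl F E n (c.val * d.val) * x.val = incl F E n c.val * (incl F E n d.val * x.val)
    rw [map_mul, mul_assoc])
  smul_zero c := Subtype.ext (mul_zero _)
  smul_add c x y := Subtype.ext (mul_add _ x.val y.val)
  add_smul c d x := Subtype.ext (by
    change incl F E n (c.val + d.val) * x.val = incl F E n c.val * x.val + incl F E n d.val * x.val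
    rw [map_add, add_mul])
  zero_smul x := Subtype.ext (by
    change incl F E n 0 * x.val = 0
    rw [map_zero, zero_mul])

theorem JSpace.val_smul (c : KField F hη ℓ) (x : JSpace F E hη ℓ) :
    (c • x).val = incl F E n c.val * x.val := rfl

end JSpace

/-! ### Trace forms -/

/-- The three kinds of trace forms for an extension `E` of `𝔽_q`: `∗`, ordinary (`0`), and
Hermitian (with parameter `γ`). -/
inductive TraceForm (E : Type*) where
  | star : TraceForm E
  | ordinary : TraceForm E
  | hermitian (γ : E) : TraceForm E

/-- The condition on `t = [E : F]`, where `F = 𝔽_q`, under which a form is defined: `t ≢ 1 mod p`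
for `∗`, nothing for the ordinary form, and `t` even for the Hermitian form. In the last case
`γ ≠ 0` is an element of the subfield with `q ^ (2 ^ a)` elements such that
`γ + γ ^ (q ^ (2 ^ (a - 1))) = 0`, where `t = 2 ^ a m` with `m` odd. -/
def TraceForm.Admissible (F : Type*) {E : Type*} [Field F] [Fintype F] [Field E] [Algebra F E] :
    TraceForm E → Prop
  | .star => ¬ finrank F E ≡ 1 [MOD ringChar F]
  | .ordinary => True
  | .hermitian γ => Even (finrank F E) ∧ γ ≠ 0 ∧
      γ ^ Fintype.card F ^ 2 ^ padicValNat 2 (finrank F E) = γ ∧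
      γ + γ ^ Fintype.card F ^ 2 ^ (padicValNat 2 (finrank F E) - 1) = 0

/-- The forms `(·,·)_δ` on `E ^ n`, with values in `F`. -/
def vecForm (F : Type*) {E : Type*} [Field F] [Fintype F] [Field E] [Algebra F E] {n : ℕ} :
    TraceForm E → (Fin n → E) → (Fin n → E) → F
  | .star, a, b => ∑ j, Algebra.trace F E
      (a j * ∑ w ∈ Finset.Ico 1 (finrank F E), b j ^ Fintype.card F ^ w)
  | .ordinary, a, b => ∑ j, Algebra.trace F E (a j * b j)
  | .hermitian γ, a, b => ∑ j, Algebra.trace F E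
      (γ * a j * b j ^ Fintype.card F ^ (finrank F E / 2))

/-- The forms `[·,·]_δ` on `E[X] / ⟨X ^ n - 1⟩`. Their values lie in the image of
`F[X] / ⟨X ^ n - 1⟩`. -/
def ringForm (F : Type*) {E : Type*} [Field F] [Fintype F] [Field E] [Algebra F E] {n : ℕ} :
    TraceForm E → Rn E n → Rn E n → Rn E n
  | .star, a, b => ∑ u ∈ Finset.range (finrank F E),
      tau F u 1 (a * ∑ w ∈ Finset.Ico 1 (finrank F E), tau F w (-1) b)
  | .ordinary, a, b => ∑ w ∈ Finset.range (finrank F E), tau F w 1 (a * tau F 0 (-1) b)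
  | .hermitian γ, a, b => ∑ w ∈ Finset.range (finrank F E),
      tau F w 1 (AdjoinRoot.of _ γ * a * tau F (finrank F E / 2) (-1) b)

/-- An `F`-linear code `C ⊆ E ^ n` is cyclic if it is stable under
`(c_0, …, c_{n-1}) ↦ (c_{n-1}, c_0, …, c_{n-2})`. -/
def IsCyclic {F E : Type*} [Field F] [Field E] [Algebra F E] {n : ℕ} [NeZero n]
    (C : Submodule F (Fin n → E)) : Prop :=
  ∀ c ∈ C, (fun j => c (j - 1)) ∈ C

/-- The `δ`-dual code `{v : (v, c)_δ = 0 for all c ∈ C}`. -/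
def dualCode {F E : Type*} [Field F] [Fintype F] [Field E] [Algebra F E] {n : ℕ}
    (δ : TraceForm E) (C : Submodule F (Fin n → E)) : Set (Fin n → E) :=
  {v | ∀ c ∈ C, vecForm F δ v c = 0}

/-- The orthogonal complement in `𝒥` of a `𝒦`-subspace `C` of `𝒥` with respect to `[·,·]_δ`. -/
def orthComp {F E L : Type*} [Field F] [Fintype F] [Field E] [Algebra F E] [Field L]
    [Algebra F L] [Algebra E L] [IsScalarTower F E L] {n : ℕ} [NeZero n] {η : L}
    {hη : IsPrimitiveRoot η n} {ℓ : ZMod n} (δ : TraceForm E)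
    (C : Submodule (KField F hη ℓ) (JSpace F E hη ℓ)) : Set (JSpace F E hη ℓ) :=
  {a | ∀ c ∈ C, ringForm F δ a.val c.val = 0}

/-- A unitary form: a non-degenerate Hermitian sesquilinear form with respect to an
automorphism of order `2`. -/
def IsUnitaryForm {K V : Type*} [Field K] [AddCommGroup V] [Module K V] {σ : K →+* K}
    (B : V →ₗ[K] V →ₛₗ[σ] K) : Prop :=
  (∀ x, σ (σ x) = x) ∧ σ ≠ RingHom.id K ∧ (∀ a b, B a b = σ (B b a)) ∧
    ∀ a, (∀ b, B a b = 0) → a = 0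

end CyclicCode

end

open CyclicCode

/-!
Write `q = |F|`, `t = [E : F]`, `d = |C_ℓ|`, and let `e` be the idempotent generator of `𝒦`.

A class modulo `X ^ n - 1` is determined by its values at the `n`-th roots of unity
(`ext_evalAt`), and `e` is the class whose values are the indicator function of the coset of `ℓ`
(`evalAt_e`). Since this coset is stable under negation, `τ_{1,-1}` fixes `e` (`tau_neg_e`) and
acts on `𝒦` as an involution, which is not the identity because `2 ℓ ≠ 0`. Evaluation at `η ^ ℓ`
identifies `𝒦` with `F(η ^ ℓ)`, so `|𝒦| = q ^ d` (`card_KField`). The `q ^ t`-cosets of the elements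
`ℓ q ^ j` with `j < gcd (d, t)` cover the `q`-coset of `ℓ`, hence `𝒥` is the ideal generated by `e`
in the larger ring (`mem_JIdeal_iff`), and an `F`-basis of `E` gives a `𝒦`-basis of `𝒥`
(`finrank_JSpace`).

All three ring forms are `[a, b] = T (a * β b)`, where `T = ∑_{w < t} τ_{q ^ w, 1}` is the
coefficientwise trace and `β` is an additive map that is semilinear over the small ring
(`ringForm_eq`, `adj_incl_mul`). Non-degeneracy follows from that of the trace form of `E / F` and
from the injectivity of `β` (`eq_zero_of_adj_eq_zero`). The forms `∗` and `0` are Hermitian; the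
form with parameter `γ` is skew-Hermitian because `γ ^ (q ^ (t / 2)) = -γ`, and a multiple by an
element `v` of `𝒦` with `σ v = -v` is Hermitian (`exists_isUnitaryForm_smul`).

The coefficients of `[a, b]` are the values `(a, b')` at the cyclic shifts `b'` of `b`
(`ringForm_toRn`). Together with `[e a, c] = [a, e c]` this gives the statement on dual codes
(`mem_dualCode_iff`).

The condition on `𝒞_i` in the count says that the Hermitian form is non-degenerate on `𝒞_i`.
In a Hermitian space over a field with `Q ^ 2` elements, splitting off an anisotropic vector
gives a recursion for the number of isotropic vectors, which therefore depends only on the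
dimension (`card_anisotropic`). Counting the pairs of an anisotropic vector `u` and a non-degenerate
subspace that contains `u` in two ways reduces dimension `k` to dimension `k - 1` in the orthogonal
complement of `u` (`card_nondeg_mul`), which yields the product formula (`card_nondeg`); here
`Q = q ^ (d / 2)`.
-/

namespace CyclicCode

/-! ### Involutions of finite fields -/

section Involution

variable {K : Type*} [Field K] {σ : K →+* K}

/-- The trace `c ↦ c + σ c` of a nontrivial involution is not zero. -/
theorem exists_add_conj_ne_zero (hne : σ ≠ RingHom.id K) : ∃ c, c + σ c ≠ 0 := by
  by_contra! h
  refine hne (RingHom.ext fun c => ?_)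
  have h1 := h 1
  rw [map_one] at h1
  change σ c = c
  linear_combination h c - c * h1

theorem exists_conj_eq_neg (hσ : ∀ x, σ (σ x) = x) (hne : σ ≠ RingHom.id K) :
    ∃ v, v ≠ 0 ∧ σ v = -v := by
  obtain ⟨c, hc⟩ : ∃ c, σ c ≠ c := by
    by_contra! h
    exact hne (RingHom.ext h)
  exact ⟨c - σ c, sub_ne_zero.2 (Ne.symm hc), by rw [map_sub, hσ]; ring⟩

/-- If `σ c ≠ c`, then `1, c` is a basis over the fixed field. -/
theorem card_eq_card_fixed_sq (hσ : ∀ x, σ (σ x) = x) (hne : σ ≠ RingHom.id K) :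
    Nat.card K = Nat.card {x // σ x = x} ^ 2 := by
  obtain ⟨c, hc⟩ : ∃ c, σ c ≠ c := by
    by_contra! h
    exact hne (RingHom.ext h)
  have hc' : c - σ c ≠ 0 := sub_ne_zero.2 (Ne.symm hc)
  rw [sq, ← Nat.card_prod]
  symm
  refine Nat.card_eq_of_bijective
    (fun z : {x // σ x = x} × {x // σ x = x} => z.1.1 + z.2.1 * c) ⟨?_, ?_⟩
  · rintro ⟨⟨a, ha⟩, ⟨b, hb⟩⟩ ⟨⟨a', ha'⟩, ⟨b', hb'⟩⟩ h
    simp only at h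
    have h2 := congrArg σ h
    simp only [map_add, map_mul, ha, hb, ha', hb'] at h2
    have hbb : b = b' := by
      have : (b - b') * (c - σ c) = 0 := by linear_combination h - h2
      exact sub_eq_zero.1 ((mul_eq_zero.1 this).resolve_right hc')
    subst hbb
    have haa : a = a' := by simpa using h
    subst haa
    rfl
  · intro x
    have hb : σ ((x - σ x) / (c - σ c)) = (x - σ x) / (c - σ c) := by
      rw [map_div₀, map_sub, map_sub, hσ, hσ, ← neg_sub x, ← neg_sub c, neg_div_neg_eq]
    refine ⟨(⟨x - (x - σ x) / (c - σ c) * c, ?_⟩, ⟨_, hb⟩), by simp⟩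
    rw [map_sub, map_mul, hb]
    have : (x - σ x) / (c - σ c) * (c - σ c) = x - σ x := div_mul_cancel₀ _ hc'
    linear_combination this

/-- Over a finite field with an involution, every nonzero fixed element is the norm of exactly
`Q + 1` elements, where `Q` is the order of the fixed field. Hilbert's theorem 90 identifies the
kernel of the norm with the image of `b ↦ b / σ b`; comparing orders gives surjectivity. -/
theorem card_norm_fiber [Finite K] (hσ : ∀ x, σ (σ x) = x) (hne : σ ≠ RingHom.id K)
    {s : K} (hs0 : s ≠ 0) (hs : σ s = s) :
    Nat.card {a // a * σ a = s} = Nat.card {x // σ x = x} + 1 := by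
  classical
  let τ : Kˣ →* Kˣ := Units.map (σ : K →* K)
  have hτ : ∀ a, τ (τ a) = a := fun a => Units.ext (hσ a)
  let N : Kˣ →* Kˣ := MonoidHom.id _ * τ
  let D : Kˣ →* Kˣ := MonoidHom.id _ / τ
  have hN : ∀ a, N a = a * τ a := fun _ => rfl
  have hD : ∀ a, D a = a / τ a := fun _ => rfl
  have h90 : N.ker = D.range := by
    ext a
    rw [MonoidHom.mem_ker, hN, MonoidHom.mem_range]
    constructor
    -- For `a * σ a = 1` every `b = c + a * σ c` satisfies `a * σ b = b`; some `c` makes it nonzero.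
    · intro ha
      have ha' : (a : K) * σ a = 1 := congrArg Units.val ha
      obtain ⟨c, hc⟩ : ∃ c : K, c + a * σ c ≠ 0 := by
        by_contra! h
        have h1 := h 1
        rw [map_one, mul_one] at h1
        refine hne (RingHom.ext fun c => ?_)
        change σ c = c
        linear_combination -h c + σ c * h1
      refine ⟨Units.mk0 _ hc, ?_⟩
      rw [hD, div_eq_iff_eq_mul]
      refine Units.ext ?_
      change c + a * σ c = a * σ (c + a * σ c)
      rw [map_add, map_mul, hσ]
      linear_combination -c * ha'
    · rintro ⟨b, rfl⟩
      rw [hD, _root_.map_div, hτ, div_mul_div_cancel, div_self']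
  have hle : N.range ≤ D.ker := by
    rintro _ ⟨a, rfl⟩
    rw [MonoidHom.mem_ker, hD, hN, map_mul, hτ, mul_comm, div_self']
  have cN := N.ker.card_mul_index
  rw [Subgroup.index_ker] at cN
  have cD := D.ker.card_mul_index
  rw [Subgroup.index_ker] at cD
  rw [h90] at cN
  have hpos : 0 < Nat.card D.range := Nat.card_pos
  have hcard : Nat.card N.range = Nat.card D.ker := by
    apply Nat.eq_of_mul_eq_mul_left hpos
    rw [cN, ← cD, mul_comm]
  have heq : N.range = D.ker := Subgroup.eq_of_le_of_card_ge hle hcard.ge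
  have hQ : Nat.card D.ker + 1 = Nat.card {x // σ x = x} := by
    have e : D.ker ≃ {x : {x // σ x = x} // x ≠ ⟨0, map_zero σ⟩} :=
      { toFun := fun a => ⟨⟨a.1, by
          have := a.2
          rw [MonoidHom.mem_ker, hD, div_eq_one] at this
          exact (congrArg Units.val this).symm⟩, fun h => a.1.ne_zero (congrArg Subtype.val h)⟩
        invFun := fun x => ⟨Units.mk0 x.1.1 fun h => x.2 (Subtype.ext h), by
          rw [MonoidHom.mem_ker, hD, div_eq_one]
          exact Units.ext x.1.2.symm⟩
        left_inv := fun a => by ext; rfl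
        right_inv := fun x => by ext; rfl }
    rw [Nat.card_congr e]
    have := Fintype.ofFinite {x // σ x = x}
    rw [Nat.card_eq_fintype_card, Nat.card_eq_fintype_card, Fintype.card_subtype_compl,
      Fintype.card_subtype_eq]
    exact Nat.sub_add_cancel (Fintype.card_pos_iff.2 ⟨⟨0, map_zero σ⟩⟩)
  have hu : Nat.card Kˣ + 1 = Nat.card K := by
    rw [Nat.card_units, Nat.sub_add_cancel Nat.card_pos]
  -- `|ker N| * (Q - 1) = |Kˣ| = Q ^ 2 - 1`.
  have hker : Nat.card N.ker = Nat.card {x // σ x = x} + 1 := by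
    rw [card_eq_card_fixed_sq hσ hne, ← hQ, ← cD, ← h90] at hu
    rw [← hQ]
    apply Nat.eq_of_mul_eq_mul_left (Nat.card_pos (α := D.ker))
    linarith
  obtain ⟨b, hb⟩ : Units.mk0 s hs0 ∈ N.range := by
    rw [heq, MonoidHom.mem_ker, hD, div_eq_one]
    exact Units.ext hs.symm
  have hb' : (b : K) * σ b = s := congrArg Units.val hb
  rw [← hker]
  have hne0 : ∀ a : {a // a * σ a = s}, a.1 ≠ 0 := by
    rintro ⟨a, ha⟩ rfl
    exact hs0 (by simpa using ha.symm)
  exact Nat.card_congr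
    { toFun := fun a => ⟨Units.mk0 a.1 (hne0 a) / b, by
        rw [MonoidHom.mem_ker, _root_.map_div, hb, div_eq_one]
        exact Units.ext a.2⟩
      invFun := fun a => ⟨(a.1 * b : Kˣ), by
        have h : N (a.1 * b) = Units.mk0 s hs0 := by
          rw [map_mul, MonoidHom.mem_ker.1 a.2, one_mul, hb]
        exact congrArg Units.val h⟩
      left_inv := fun a => by ext; simp
      right_inv := fun a => by ext; simp }

end Involution

/-! ### Non-degenerate subspaces of Hermitian spaces -/

section Hermitian

variable {K V : Type*} [Field K] [AddCommGroup V] [Module K V] {σ : K →+* K}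
  (B : V →ₗ[K] V →ₛₗ[σ] K)

/-- The hyperplane of vectors `w` with `B w u = 0`. -/
def perp (u : V) : Submodule K V := LinearMap.ker (B.flip u)

/-- The restriction of `B` to the subspace `W` is non-degenerate. -/
def NondegOn (W : Submodule K V) : Prop := ∀ a ∈ W, (∀ b ∈ W, B a b = 0) → a = 0

variable {B}

theorem mem_perp {u w : V} : w ∈ perp B u ↔ B w u = 0 := Iff.rfl

theorem sub_smul_mem_perp {u : V} (hu : B u u ≠ 0) (w : V) :
    w - (B w u / B u u) • u ∈ perp B u := by
  rw [mem_perp, map_sub, map_smul, LinearMap.sub_apply, LinearMap.smul_apply, smul_eq_mul,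
    div_mul_cancel₀ _ hu, sub_self]

theorem herm_swap_eq_zero (hH : ∀ a b, B a b = σ (B b a)) {a b : V} (h : B a b = 0) :
    B b a = 0 := by
  rw [hH, h, map_zero]

/-- Polarization: a form that vanishes on the diagonal of `W` has `B a b + σ (B a b) = 0` there,
and scaling `a` gives all of `K` as values of `B a b` unless `B` vanishes on `W`. -/
theorem exists_anisotropic (hne : σ ≠ RingHom.id K) (hH : ∀ a b, B a b = σ (B b a))
    {W : Submodule K V} (hW : NondegOn B W) (hbot : W ≠ ⊥) : ∃ u ∈ W, B u u ≠ 0 := by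
  by_contra! h
  obtain ⟨a, ha, ha0⟩ := W.exists_mem_ne_zero_of_ne_bot hbot
  refine ha0 (hW a ha fun b hb => ?_)
  by_contra hab
  obtain ⟨c, hc⟩ := exists_add_conj_ne_zero hne
  apply hc
  have ha' : (c / B a b) • a ∈ W := W.smul_mem _ ha
  have h1 := h _ (W.add_mem ha' hb)
  have h2 : B ((c / B a b) • a) b = c := by
    rw [map_smul, LinearMap.smul_apply, smul_eq_mul, div_mul_cancel₀ _ hab]
  rw [map_add, map_add, LinearMap.add_apply, LinearMap.add_apply, h _ ha', h _ hb, h2,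
    hH b, h2] at h1
  linear_combination h1

/-- Splitting off an anisotropic vector of `W` keeps the form non-degenerate. -/
theorem NondegOn.inf_perp {W : Submodule K V} (hW : NondegOn B W) {u : V} (huW : u ∈ W)
    (hu : B u u ≠ 0) : NondegOn B (W ⊓ perp B u) := by
  intro a ha h
  refine hW a ha.1 fun b hb => ?_
  have h1 := h _ ⟨W.sub_mem hb (W.smul_mem _ huW), sub_smul_mem_perp hu b⟩
  rwa [map_sub, map_smulₛₗ, mem_perp.1 ha.2, smul_zero, sub_zero] at h1

theorem NondegOn.sup_span {W : Submodule K V} (hW : NondegOn B W) {u : V}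
    (hWu : W ≤ perp B u) (hu : B u u ≠ 0) : NondegOn B (W ⊔ K ∙ u) := by
  intro a ha h
  obtain ⟨w, hw, z, hz, rfl⟩ := Submodule.mem_sup.1 ha
  obtain ⟨r, rfl⟩ := Submodule.mem_span_singleton.1 hz
  have h1 := h u (Submodule.mem_sup_right (Submodule.mem_span_singleton_self u))
  rw [map_add, LinearMap.add_apply, mem_perp.1 (hWu hw), zero_add, map_smul,
    LinearMap.smul_apply, smul_eq_mul] at h1
  have hr : r = 0 := (mul_eq_zero.1 h1).resolve_right hu
  subst hr
  rw [zero_smul, add_zero] at h ⊢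
  exact hW w hw fun b hb => h b (Submodule.mem_sup_left hb)

theorem inf_perp_sup_span {W : Submodule K V} {u : V} (huW : u ∈ W) (hu : B u u ≠ 0) :
    (W ⊓ perp B u) ⊔ K ∙ u = W := by
  apply le_antisymm
  · exact sup_le inf_le_left ((Submodule.span_singleton_le_iff_mem _ _).2 huW)
  · intro w hw
    rw [← sub_add_cancel w ((B w u / B u u) • u)]
    exact Submodule.add_mem_sup ⟨W.sub_mem hw (W.smul_mem _ huW), sub_smul_mem_perp hu w⟩
      (Submodule.smul_mem _ _ (Submodule.mem_span_singleton_self u))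

theorem sup_span_inf_perp {W : Submodule K V} {u : V} (hWu : W ≤ perp B u) (hu : B u u ≠ 0) :
    (W ⊔ K ∙ u) ⊓ perp B u = W := by
  apply le_antisymm
  · rintro a ⟨ha, hau⟩
    obtain ⟨w, hw, z, hz, rfl⟩ := Submodule.mem_sup.1 ha
    obtain ⟨r, rfl⟩ := Submodule.mem_span_singleton.1 hz
    have h1 : B (w + r • u) u = 0 := hau
    rw [map_add, LinearMap.add_apply, mem_perp.1 (hWu hw), zero_add, map_smul,
      LinearMap.smul_apply, smul_eq_mul] at h1
    have hr : r = 0 := (mul_eq_zero.1 h1).resolve_right hu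
    subst hr
    simpa using hw
  · exact le_inf le_sup_left hWu

theorem finrank_sup_span [FiniteDimensional K V] {W : Submodule K V} {u : V}
    (hWu : W ≤ perp B u) (hu : B u u ≠ 0) :
    finrank K ↥(W ⊔ K ∙ u) = finrank K W + 1 := by
  have hu0 : u ≠ 0 := by
    rintro rfl
    simp at hu
  have hdis : W ⊓ K ∙ u = ⊥ := by
    rw [eq_bot_iff]
    rintro x ⟨hxW, hx⟩
    obtain ⟨r, rfl⟩ := Submodule.mem_span_singleton.1 hx
    have h1 : B (r • u) u = 0 := hWu hxW
    rw [map_smul, LinearMap.smul_apply, smul_eq_mul] at h1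
    rw [(mul_eq_zero.1 h1).resolve_right hu, zero_smul]
    exact Submodule.zero_mem _
  have h := Submodule.finrank_sup_add_finrank_inf_eq W (K ∙ u)
  rwa [hdis, finrank_bot, finrank_span_singleton hu0] at h

theorem finrank_inf_perp [FiniteDimensional K V] {W : Submodule K V} {u : V} (huW : u ∈ W)
    (hu : B u u ≠ 0) : finrank K ↥(W ⊓ perp B u) + 1 = finrank K W := by
  rw [← finrank_sup_span inf_le_right hu, inf_perp_sup_span huW hu]

/-- Splitting off an anisotropic vector `u`: the vector `w + a • u` is isotropic exactly when the
norm of `a` is `-B w w / B u u`. -/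
theorem card_isotropic_eq_sum (hH : ∀ a b, B a b = σ (B b a))
    {W : Submodule K V} {u : V} (huW : u ∈ W) (hu : B u u ≠ 0)
    [Fintype ↥(W ⊓ perp B u)] [Finite K] :
    Nat.card {v : W // B v v = 0} =
      ∑ w : ↥(W ⊓ perp B u), Nat.card {a : K // a * σ a = -B w w / B u u} := by
  rw [← Nat.card_sigma, ← Nat.card_congr (Equiv.subtypeProdEquivSigmaSubtype
    (fun (w : ↥(W ⊓ perp B u)) (a : K) => a * σ a = -B w w / B u u))]
  have key : ∀ w ∈ perp B u, ∀ a : K,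
      B (w + a • u) (w + a • u) = B w w + a * σ a * B u u := by
    intro w hw a
    have h1 : B w u = 0 := hw
    have h2 := herm_swap_eq_zero hH h1
    simp only [map_add, LinearMap.add_apply, map_smul, LinearMap.smul_apply, map_smulₛₗ, h1, h2,
      smul_eq_mul]
    ring
  symm
  refine Nat.card_eq_of_bijective (fun p => ⟨⟨p.1.1.1 + p.1.2 • u,
    W.add_mem p.1.1.2.1 (W.smul_mem _ huW)⟩, ?_⟩) ⟨?_, ?_⟩
  · change B (p.1.1.1 + p.1.2 • u) (p.1.1.1 + p.1.2 • u) = 0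
    rw [key _ p.1.1.2.2, p.2, div_mul_cancel₀ _ hu, add_neg_cancel]
  · rintro ⟨⟨⟨w, hw⟩, a⟩, h⟩ ⟨⟨⟨w', hw'⟩, a'⟩, h'⟩ heq
    have heq : w + a • u = w' + a' • u := congrArg (fun z => z.1.1) heq
    have haa : a = a' := by
      have h1 := congrArg (fun z => B z u) heq
      simp only [map_add, LinearMap.add_apply, map_smul, LinearMap.smul_apply, mem_perp.1 hw.2,
        mem_perp.1 hw'.2, zero_add, smul_eq_mul] at h1
      exact mul_right_cancel₀ hu h1
    subst haa
    have hww : w = w' := add_right_cancel heq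
    subst hww
    rfl
  · rintro ⟨⟨v, hv⟩, h⟩
    have hp := sub_smul_mem_perp hu v
    refine ⟨⟨⟨⟨v - (B v u / B u u) • u, W.sub_mem hv (W.smul_mem _ huW), hp⟩, B v u / B u u⟩, ?_⟩,
      ?_⟩
    · have h1 := key _ hp (B v u / B u u)
      rw [sub_add_cancel] at h1
      rw [eq_div_iff hu]
      change _ = -B (v - (B v u / B u u) • u) (v - (B v u / B u u) • u)
      change B v v = 0 at h
      linear_combination h - h1
    · simp

variable [Finite V]

/-- Double counting of pairs `u ∈ X` with `X ≤ W` non-degenerate of dimension `k + 1` and `u`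
anisotropic: `X ↦ X ⊓ perp B u` identifies the subspaces `X` that contain `u` with the
non-degenerate `k`-dimensional subspaces of `W ⊓ perp B u`. -/
theorem card_nondeg_mul (W : Submodule K V) (k : ℕ) (a b N : ℚ)
    (ha : ∀ X : Submodule K V, NondegOn B X → finrank K X = k + 1 →
      (Nat.card {v : X // B v v ≠ 0} : ℚ) = a)
    (hb : (Nat.card {v : W // B v v ≠ 0} : ℚ) = b)
    (hN : ∀ u ∈ W, B u u ≠ 0 → (Nat.card {X : Submodule K V //
      X ≤ W ⊓ perp B u ∧ NondegOn B X ∧ finrank K X = k} : ℚ) = N) :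
    (Nat.card {X : Submodule K V // X ≤ W ∧ NondegOn B X ∧ finrank K X = k + 1} : ℚ) * a
      = b * N := by
  classical
  have := Fintype.ofFinite V
  have := Fintype.ofFinite (Submodule K V)
  rw [← hb]
  have e : {v : W // B v v ≠ 0} ≃ {v : V // v ∈ W ∧ B v v ≠ 0} :=
    Equiv.subtypeSubtypeEquivSubtypeInter (fun v => v ∈ W) (fun v => B v v ≠ 0)
  rw [Nat.card_congr e, Nat.card_eq_fintype_card, Nat.card_eq_fintype_card,
    Fintype.card_subtype, Fintype.card_subtype]
  have hs := congrArg (Nat.cast : ℕ → ℚ)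
    (Finset.sum_card_bipartiteAbove_eq_sum_card_bipartiteBelow
      (s := {X : Submodule K V | X ≤ W ∧ NondegOn B X ∧ finrank K X = k + 1})
      (t := {v : V | v ∈ W ∧ B v v ≠ 0}) (fun X u => u ∈ X))
  rw [Nat.cast_sum, Nat.cast_sum, Finset.sum_congr rfl (g := fun _ => a),
    Finset.sum_congr (s₂ := {v : V | v ∈ W ∧ B v v ≠ 0}) rfl (g := fun _ => N),
    Finset.sum_const, Finset.sum_const, nsmul_eq_mul, nsmul_eq_mul] at hs
  · exact hs
  rotate_left
  · intro X hX
    simp only [Finset.mem_filter, Finset.mem_univ, true_and] at hX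
    rw [← ha X hX.2.1 hX.2.2, Nat.card_congr (Equiv.subtypeSubtypeEquivSubtypeInter
      (fun v => v ∈ X) (fun v => B v v ≠ 0)), Nat.card_eq_fintype_card, Fintype.card_subtype]
    congr 2
    ext v
    simp only [Finset.mem_bipartiteAbove, Finset.mem_filter, Finset.mem_univ, true_and]
    exact ⟨fun h => ⟨h.2, h.1.2⟩, fun h => ⟨⟨hX.1 h.1, h.2⟩, h.1⟩⟩
  · intro u hu
    simp only [Finset.mem_filter, Finset.mem_univ, true_and] at hu
    rw [← hN u hu.1 hu.2, Nat.card_eq_fintype_card, Fintype.card_subtype]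
    refine congrArg Nat.cast (Finset.card_nbij' (fun X => X ⊓ perp B u) (fun X => X ⊔ K ∙ u)
      ?_ ?_ ?_ ?_)
    · intro X hX
      simp only [Finset.mem_coe, Finset.mem_bipartiteBelow, Finset.mem_filter, Finset.mem_univ,
        true_and] at hX ⊢
      obtain ⟨⟨h1, h2, h3⟩, h4⟩ := hX
      refine ⟨inf_le_inf_right _ h1, h2.inf_perp h4 hu.2, ?_⟩
      have := finrank_inf_perp h4 hu.2
      omega
    · intro X hX
      simp only [Finset.mem_coe, Finset.mem_bipartiteBelow, Finset.mem_filter, Finset.mem_univ,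
        true_and] at hX ⊢
      obtain ⟨h1, h2, h3⟩ := hX
      have h4 := h1.trans inf_le_right
      refine ⟨⟨sup_le (h1.trans inf_le_left) ((Submodule.span_singleton_le_iff_mem _ _).2 hu.1),
        h2.sup_span h4 hu.2, ?_⟩, Submodule.mem_sup_right (Submodule.mem_span_singleton_self u)⟩
      rw [finrank_sup_span h4 hu.2, h3]
    · intro X hX
      simp only [Finset.mem_coe, Finset.mem_bipartiteBelow] at hX
      exact inf_perp_sup_span hX.2 hu.2
    · intro X hX
      simp only [Finset.mem_coe, Finset.mem_filter, Finset.mem_univ, true_and] at hX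
      exact sup_span_inf_perp (hX.1.trans inf_le_right) hu.2

variable [Finite K]

/-- The number of isotropic vectors of `W` satisfies a linear recursion in the dimension. -/
theorem card_isotropic_step (hσ : ∀ x, σ (σ x) = x) (hne : σ ≠ RingHom.id K)
    (hH : ∀ a b, B a b = σ (B b a)) {W : Submodule K V} {u : V} (huW : u ∈ W) (hu : B u u ≠ 0) :
    (Nat.card {v : W // B v v = 0} : ℚ) =
      (Nat.card {x // σ x = x} + 1) * Nat.card ↥(W ⊓ perp B u)
        - Nat.card {x // σ x = x} * Nat.card {w : ↥(W ⊓ perp B u) // B w w = 0} := by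
  classical
  have := Fintype.ofFinite ↥(W ⊓ perp B u)
  set Q := Nat.card {x // σ x = x}
  -- For isotropic `w` only `a = 0` is possible; otherwise the norm is prescribed and nonzero.
  have hfib : ∀ w : ↥(W ⊓ perp B u), (Nat.card {a : K // a * σ a = -B w w / B u u} : ℚ)
      = (Q + 1) - Q * (if B w w = 0 then 1 else 0) := by
    intro w
    split_ifs with h
    · have hs : ∀ a : K, a * σ a = -B w w / B u u ↔ a = 0 := by
        intro a
        rw [h, neg_zero, zero_div, mul_eq_zero, map_eq_zero, or_self]
      simp [hs]
    · rw [card_norm_fiber hσ hne (div_ne_zero (neg_ne_zero.2 h) hu)]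
      · push_cast; ring
      · rw [map_div₀, map_neg, ← hH, ← hH]
  rw [card_isotropic_eq_sum hH huW hu, Nat.cast_sum, Finset.sum_congr rfl fun w _ => hfib w,
    Finset.sum_sub_distrib, ← Finset.mul_sum, Finset.sum_const, Finset.card_univ,
    Finset.sum_boole, nsmul_eq_mul, Nat.card_eq_fintype_card,
    Nat.card_eq_fintype_card (α := {w : ↥(W ⊓ perp B u) // B w w = 0}),
    Fintype.card_subtype (fun w : ↥(W ⊓ perp B u) => B w w = 0)]
  ring

/-- The number of anisotropic vectors of a non-degenerate Hermitian space depends only on its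
dimension. -/
theorem card_anisotropic (hσ : ∀ x, σ (σ x) = x) (hne : σ ≠ RingHom.id K)
    (hH : ∀ a b, B a b = σ (B b a)) (m : ℕ) :
    ∀ W : Submodule K V, NondegOn B W → finrank K W = m →
      (Nat.card {x // σ x = x} : ℚ) * Nat.card {v : W // B v v ≠ 0} =
        (Nat.card {x // σ x = x} : ℚ) ^ m * (Nat.card {x // σ x = x} - 1) *
          ((Nat.card {x // σ x = x} : ℚ) ^ m - (-1) ^ m) := by
  classical
  have hcompl : ∀ W : Submodule K V, (Nat.card {v : W // B v v ≠ 0} : ℚ)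
      = (Nat.card {x // σ x = x} : ℚ) ^ (2 * finrank K W) - Nat.card {v : W // B v v = 0} := by
    intro W
    have h1 : Nat.card W = Nat.card {x // σ x = x} ^ (2 * finrank K W) := by
      rw [Module.natCard_eq_pow_finrank (K := K), card_eq_card_fixed_sq hσ hne, pow_mul]
    have := Fintype.ofFinite W
    have h2 := Fintype.card_subtype_compl (fun v : W => B v v = 0)
    have h3 := Fintype.card_subtype_le (fun v : W => B v v = 0)
    rw [← Nat.cast_pow, ← h1, Nat.card_eq_fintype_card, Nat.card_eq_fintype_card,
      Nat.card_eq_fintype_card, h2, Nat.cast_sub h3]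
  induction m with
  | zero =>
    intro W hW h0
    rw [Submodule.finrank_eq_zero] at h0
    subst h0
    have : IsEmpty {v : (⊥ : Submodule K V) // B v v ≠ 0} := by
      refine ⟨fun v => v.2 ?_⟩
      rw [Subsingleton.elim v.1 0]
      simp
    simp
  | succ m ih =>
    intro W hW hm
    obtain ⟨u, huW, hu⟩ := exists_anisotropic hne hH hW (by
      rintro rfl
      simp at hm)
    have hr := finrank_inf_perp huW hu
    have hr' : finrank K ↥(W ⊓ perp B u) = m := by omega
    have h1 := ih _ (hW.inf_perp huW hu) hr'
    rw [hcompl, hr'] at h1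
    rw [hcompl, card_isotropic_step hσ hne hH huW hu,
      Module.natCard_eq_pow_finrank (K := K) (V := ↥(W ⊓ perp B u)),
      card_eq_card_fixed_sq hσ hne, hr', hm]
    push_cast
    set Q : ℚ := (Nat.card {x // σ x = x} : ℚ)
    linear_combination (-Q) * h1

/-- The number of non-degenerate `k`-dimensional subspaces of a non-degenerate Hermitian space of
dimension `n` over a field with fixed field of order `Q`. -/
theorem card_nondeg (hσ : ∀ x, σ (σ x) = x) (hne : σ ≠ RingHom.id K)
    (hH : ∀ a b, B a b = σ (B b a)) (k : ℕ) :
    ∀ (n : ℕ) (W : Submodule K V), NondegOn B W → finrank K W = n → k ≤ n →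
      (Nat.card {X : Submodule K V // X ≤ W ∧ NondegOn B X ∧ finrank K X = k} : ℚ) =
        (Nat.card {x // σ x = x} : ℚ) ^ (k * (n - k)) * ∏ j ∈ Finset.range k,
          (((Nat.card {x // σ x = x} : ℚ) ^ (n - j) - (-1) ^ (n - j)) /
            ((Nat.card {x // σ x = x} : ℚ) ^ (k - j) - (-1) ^ (k - j))) := by
  have hQ : (1 : ℚ) < Nat.card {x // σ x = x} := by
    have : Nontrivial {x // σ x = x} :=
      ⟨⟨0, map_zero σ⟩, ⟨1, map_one σ⟩, fun h => zero_ne_one (congrArg Subtype.val h)⟩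
    exact_mod_cast Finite.one_lt_card
  have hA := card_anisotropic hσ hne hH
  set Q : ℚ := (Nat.card {x // σ x = x} : ℚ)
  have hQ0 : Q ≠ 0 := by positivity
  have hpow : ∀ m : ℕ, 0 < m → Q ^ m - (-1) ^ m ≠ 0 := by
    intro m hm
    have h1 : 1 < Q ^ m := one_lt_pow₀ hQ hm.ne'
    rcases neg_one_pow_eq_or ℚ m with h | h <;> rw [h] <;> linarith
  induction k with
  | zero =>
    intro n W hW hn _
    have : ∀ X : Submodule K V, (X ≤ W ∧ NondegOn B X ∧ finrank K X = 0) ↔ X = ⊥ := by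
      intro X
      constructor
      · exact fun h => Submodule.finrank_eq_zero.1 h.2.2
      · rintro rfl
        exact ⟨bot_le, fun a ha _ => (Submodule.mem_bot K).1 ha, finrank_bot K V⟩
    simp only [this]
    simp
  | succ k ih =>
    intro n W hW hn hk
    obtain ⟨m, rfl⟩ : ∃ m, n = m + 1 := ⟨n - 1, by omega⟩
    have hAform : ∀ (r : ℕ) (X : Submodule K V), NondegOn B X → finrank K X = r + 1 →
        (Nat.card {v : X // B v v ≠ 0} : ℚ) = Q ^ r * (Q - 1) * (Q ^ (r + 1) - (-1) ^ (r + 1)) := by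
      intro r X hX hr
      apply mul_left_cancel₀ hQ0
      rw [hA (r + 1) X hX hr]
      ring
    have hb := hAform m W hW hn
    have h1 := card_nondeg_mul W k _ _ _ (hAform k) hb fun u huW hu =>
      ih m _ (hW.inf_perp huW hu) (by
        have := finrank_inf_perp huW hu
        omega) (by omega)
    have hk' := hpow (k + 1) k.succ_pos
    have hQ1 : Q - 1 ≠ 0 := by linarith
    have hQk : Q ^ k ≠ 0 := pow_ne_zero _ hQ0
    obtain ⟨r, rfl⟩ : ∃ r, m = k + r := ⟨m - k, by omega⟩
    rw [Finset.prod_range_succ']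
    simp only [Nat.add_sub_add_right, Nat.sub_zero, Nat.add_sub_cancel_left] at h1 ⊢
    apply mul_right_cancel₀ (mul_ne_zero (mul_ne_zero hQk hQ1) hk')
    rw [h1]
    field_simp
    ring

end Hermitian

section Hermitian

variable {K V : Type*} [Field K] [AddCommGroup V] [Module K V] {σ : K →+* K}
  {B : V →ₗ[K] V →ₛₗ[σ] K} [Finite K] [Finite V]

/-- Summing over the dimension; the two summands in front belong to the dimensions `0` and `n`. -/
theorem card_nondeg_total (hB : IsUnitaryForm B) {Q : ℕ} (hK : Nat.card K = Q ^ 2)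
    (hn : 0 < finrank K V) :
    (Nat.card {X : Submodule K V // NondegOn B X} : ℚ) =
      2 + ∑ k ∈ Finset.Icc 1 (finrank K V - 1), (Q : ℚ) ^ (k * (finrank K V - k)) *
        ∏ j ∈ Finset.range k, (((Q : ℚ) ^ (finrank K V - j) - (-1) ^ (finrank K V - j)) /
            ((Q : ℚ) ^ (k - j) - (-1) ^ (k - j))) := by
  classical
  obtain ⟨hσ, hne, hH, hnd⟩ := hB
  have hQ : Nat.card {x // σ x = x} = Q :=
    (Nat.pow_left_injective two_ne_zero (hK.symm.trans (card_eq_card_fixed_sq hσ hne))).symm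
  have htop : NondegOn B (⊤ : Submodule K V) := fun a _ h => hnd a fun b => h b trivial
  have hform := fun k hk => card_nondeg hσ hne hH k _ ⊤ htop (finrank_top K V) hk
  rw [hQ] at hform
  have := Fintype.ofFinite (Submodule K V)
  rw [Nat.card_eq_fintype_card, Fintype.card_subtype,
    Finset.card_eq_sum_card_fiberwise (f := fun X : Submodule K V => finrank K X)
      (t := Finset.range (finrank K V + 1))
      (fun X _ => Finset.mem_coe.2 (Finset.mem_range.2 (Nat.lt_succ_of_le X.finrank_le))),
    Nat.cast_sum]
  have hfib : ∀ k, Finset.card (Finset.filter (fun X : Submodule K V => finrank K X = k)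
      (Finset.univ.filter fun X => NondegOn B X)) =
      Nat.card {X : Submodule K V // X ≤ ⊤ ∧ NondegOn B X ∧ finrank K X = k} := by
    intro k
    rw [Nat.card_eq_fintype_card, Fintype.card_subtype, Finset.filter_filter]
    simp
  rw [Finset.sum_congr rfl fun k _ => congrArg Nat.cast (hfib k)]
  obtain ⟨m, hm⟩ : ∃ m, finrank K V = m + 1 := ⟨finrank K V - 1, by omega⟩
  have hlast : Nat.card {X : Submodule K V // X ≤ ⊤ ∧ NondegOn B X ∧ finrank K X = m + 1} = 1 := by
    have : ∀ X : Submodule K V, (X ≤ ⊤ ∧ NondegOn B X ∧ finrank K X = m + 1) ↔ X = ⊤ := by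
      intro X
      constructor
      · exact fun h => Submodule.eq_top_of_finrank_eq (h.2.2.trans hm.symm)
      · rintro rfl
        exact ⟨le_rfl, htop, (finrank_top K V).trans hm⟩
    simp only [this]
    simp
  have hfirst : (Nat.card {X : Submodule K V // X ≤ ⊤ ∧ NondegOn B X ∧ finrank K X = 0} : ℚ)
      = 1 := by
    rw [hform 0 (Nat.zero_le _)]
    simp
  rw [hm, Finset.sum_range_succ, hlast, Finset.sum_range_succ', hfirst, Nat.add_sub_cancel,
    Finset.range_eq_Ico, Finset.sum_Ico_add' (fun i => (Nat.card {X : Submodule K V //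
      X ≤ ⊤ ∧ NondegOn B X ∧ finrank K X = i} : ℚ)) 0 m 1, zero_add,
    Finset.Ico_add_one_right_eq_Icc, Finset.sum_congr rfl fun k hk => hform k (by
      have := (Finset.mem_Icc.1 hk).2
      omega), hm]
  push_cast
  ring

end Hermitian

/-! ### Coordinates modulo `X ^ n - 1` -/

section Coordinates

variable {k : Type*} [Field k] {n : ℕ}

theorem toRn_eq_sum (a : Fin n → k) :
    toRn a = ∑ j : Fin n, AdjoinRoot.of (X ^ n - 1 : k[X]) (a j) * AdjoinRoot.root _ ^ (j : ℕ) := by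
  simp [toRn]

theorem root_pow_congr {a b : ℕ} (h : (a : ZMod n) = b) :
    AdjoinRoot.root (X ^ n - 1 : k[X]) ^ a = AdjoinRoot.root (X ^ n - 1 : k[X]) ^ b :=
  pow_eq_pow_of_modEq ((ZMod.natCast_eq_natCast_iff _ _ _).1 h) (root_pow k n)

theorem toRn_add (a b : Fin n → k) : toRn (a + b) = toRn a + toRn b := by
  simp [toRn_eq_sum, add_mul, Finset.sum_add_distrib]

theorem toRn_zero : toRn (0 : Fin n → k) = 0 := by
  simp [toRn_eq_sum]

theorem toRn_sum {ι : Type*} (s : Finset ι) (f : ι → Fin n → k) :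
    toRn (∑ i ∈ s, f i) = ∑ i ∈ s, toRn (f i) :=
  map_sum (⟨⟨toRn, toRn_zero⟩, toRn_add⟩ : (Fin n → k) →+ Rn k n) f s

theorem of_mul_toRn (c : k) (a : Fin n → k) :
    AdjoinRoot.of (X ^ n - 1 : k[X]) c * toRn a = toRn (fun j => c * a j) := by
  simp [toRn_eq_sum, Finset.mul_sum, mul_assoc]

variable [NeZero n]

theorem degree_X_pow_sub_one : (X ^ n - 1 : k[X]).degree = n := by
  simpa using degree_X_pow_sub_C (NeZero.pos n) (1 : k)

theorem toRn_surjective : Function.Surjective (toRn : (Fin n → k) → Rn k n) := by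
  intro x
  obtain ⟨p, rfl⟩ := AdjoinRoot.mk_surjective x
  have hm : (X ^ n - 1 : k[X]).Monic := by simpa using monic_X_pow_sub_C (1 : k) (NeZero.ne n)
  set r := p %ₘ (X ^ n - 1) with hr
  have hdeg : r.natDegree < n := by
    rcases eq_or_ne r 0 with h0 | h0
    · rw [h0, natDegree_zero]; exact NeZero.pos n
    · rw [natDegree_lt_iff_degree_lt h0, ← degree_X_pow_sub_one (k := k)]
      exact degree_modByMonic_lt p hm
  refine ⟨fun j => r.coeff j, ?_⟩
  rw [toRn, Fin.sum_univ_eq_sum_range (fun j => C (r.coeff j) * X ^ j),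
    ← r.as_sum_range_C_mul_X_pow' hdeg, AdjoinRoot.mk_eq_mk, hr, modByMonic_eq_sub_mul_div]
  simp

theorem toRn_injective : Function.Injective (toRn : (Fin n → k) → Rn k n) := by
  intro a b hab
  rw [toRn, toRn, AdjoinRoot.mk_eq_mk, ← Finset.sum_sub_distrib] at hab
  have h : (∑ j : Fin n, C ((a - b) j) * X ^ (j : ℕ) : k[X]) = 0 := by
    refine eq_zero_of_dvd_of_degree_lt (p := X ^ n - 1) ?_ ?_
    · simpa [sub_mul] using hab
    · rw [degree_X_pow_sub_one]
      exact degree_sum_fin_lt _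
  funext j
  have hj := congrArg (fun p => p.coeff j) h
  simp only [finsetSum_coeff, coeff_C_mul_X_pow, Fin.val_inj, Finset.sum_ite_eq,
    Finset.mem_univ, if_true, coeff_zero] at hj
  exact sub_eq_zero.1 hj

end Coordinates

/-! ### Evaluation at roots of unity -/

section Evaluation

variable (k : Type*) {L : Type*} [Field k] [Field L] [Algebra k L] {n : ℕ}
  {η : L} (hη : IsPrimitiveRoot η n)

/-- Evaluation of a residue class modulo `X ^ n - 1` at the root of unity `η ^ i`. -/
noncomputable def evalAt (i : ZMod n) : Rn k n →+* L :=
  AdjoinRoot.lift (algebraMap k L) (η ^ i.val) (by simp [pow_right_comm, hη.pow_eq_one])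

theorem evalAt_mk (i : ZMod n) (p : k[X]) :
    evalAt k hη i (AdjoinRoot.mk _ p) = aeval (η ^ i.val) p := by
  rw [evalAt, AdjoinRoot.lift_mk, aeval_def]

theorem evalAt_of (i : ZMod n) (c : k) :
    evalAt k hη i (AdjoinRoot.of _ c) = algebraMap k L c := by
  rw [evalAt, AdjoinRoot.lift_of]

theorem evalAt_root (i : ZMod n) :
    evalAt k hη i (AdjoinRoot.root _) = η ^ i.val := by
  rw [evalAt, AdjoinRoot.lift_root]

variable [NeZero n]

include hη in
theorem pow_val_injective {a b : ZMod n} (h : η ^ a.val = η ^ b.val) : a = b :=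
  ZMod.val_injective n (hη.pow_inj (ZMod.val_lt a) (ZMod.val_lt b) h)

variable {k}

/-- A residue class modulo `X ^ n - 1` is determined by its values at the `n`-th roots of unity. -/
theorem ext_evalAt {x y : Rn k n} (h : ∀ i, evalAt k hη i x = evalAt k hη i y) : x = y := by
  rw [← sub_eq_zero]
  obtain ⟨a, ha⟩ := toRn_surjective (x - y)
  rw [← ha, toRn]
  set p : k[X] := ∑ j : Fin n, C (a j) * X ^ (j : ℕ) with hp
  suffices hp0 : p = 0 by rw [hp0, map_zero]
  by_contra hp0
  apply hp0
  apply map_injective _ (algebraMap k L).injective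
  rw [Polynomial.map_zero]
  refine eq_zero_of_natDegree_lt_card_of_eval_eq_zero _ (f := fun i : ZMod n => η ^ i.val)
    (fun _ _ h => pow_val_injective hη h) (fun i => ?_) ?_
  · rw [eval_map_algebraMap, ← evalAt_mk k hη]
    change evalAt k hη i (toRn a) = 0
    rw [ha, map_sub, h, sub_self]
  · rw [ZMod.card, natDegree_map, natDegree_lt_iff_degree_lt hp0]
    exact degree_sum_fin_lt _

/-- The values of the idempotent generator of a minimal ideal: it is the indicator function of
the coset. -/
theorem evalAt_idempotent [Fintype k] (m : ZMod n) {e : Rn k n} (he : e ∈ minIdeal k η m)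
    (hid : ∀ x ∈ minIdeal k η m, e * x = x) (i : ZMod n)
    [Decidable (i ∈ coset (Fintype.card k) m)] :
    evalAt k hη i e = if i ∈ coset (Fintype.card k) m then 1 else 0 := by
  obtain ⟨h1, h2⟩ := exists_cofactor k hη m
  have hf : aeval (η ^ i.val) (cosetPoly k η m) = 0 ↔ i ∈ coset (Fintype.card k) m := by
    rw [← eval_map_algebraMap, map_cosetPoly k hη, eval_prod, Finset.prod_eq_zero_iff]
    constructor
    · rintro ⟨j, hj, h⟩
      rw [eval_sub, eval_X, eval_C, sub_eq_zero] at h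
      rwa [pow_val_injective hη h]
    · exact fun h => ⟨i, h, by simp⟩
  have hg := hid _ (Ideal.mem_span_singleton_self _)
  unfold minIdeal at he
  set g := (X ^ n - 1) / cosetPoly k η m
  split_ifs with hi
  · have hgi : aeval (η ^ i.val) g ≠ 0 := by
      intro h0
      obtain ⟨a, b, hab⟩ := h2
      have := congrArg (aeval (η ^ i.val)) hab
      rw [map_add, map_mul, map_mul, hf.2 hi, h0] at this
      simp at this
    have := congrArg (evalAt k hη i) hg
    rw [map_mul, evalAt_mk] at this
    exact mul_right_cancel₀ hgi (by rw [this, one_mul])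
  · have hgi : aeval (η ^ i.val) g = 0 := by
      have := congrArg (aeval (η ^ i.val)) h1
      rw [map_mul] at this
      refine (mul_eq_zero.1 (this.trans ?_)).resolve_left (mt hf.1 hi)
      simp [pow_right_comm, hη.pow_eq_one]
    obtain ⟨c, rfl⟩ := Ideal.mem_span_singleton'.1 he
    rw [map_mul, evalAt_mk, hgi, mul_zero]

end Evaluation

/-! ### Inclusion of the small ring -/

section Inclusion

variable (F : Type*) {E : Type*} [Field F] [Field E] [Algebra F E] {n : ℕ}

theorem incl_of (c : F) :
    incl F E n (AdjoinRoot.of _ c) = AdjoinRoot.of _ (algebraMap F E c) :=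
  AdjoinRoot.map_of ..

theorem incl_root :
    incl F E n (AdjoinRoot.root (X ^ n - 1 : F[X])) = AdjoinRoot.root _ :=
  AdjoinRoot.map_root ..

theorem incl_toRn (f : Fin n → F) :
    incl F E n (toRn f) = toRn (fun j => algebraMap F E (f j)) := by
  simp [toRn_eq_sum, incl_of, incl_root]

theorem evalAt_incl {L : Type*} [Field L] [Algebra F L] [Algebra E L] [IsScalarTower F E L]
    {η : L} (hη : IsPrimitiveRoot η n) (i : ZMod n) (x : Rn F n) :
    evalAt E hη i (incl F E n x) = evalAt F hη i x := by
  have : (evalAt E hη i).comp (incl F E n) = evalAt F hη i := by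
    refine AdjoinRoot.ringHom_ext (RingHom.ext fun c => ?_) ?_
    · simp only [RingHom.comp_apply, incl_of, evalAt_of, ← IsScalarTower.algebraMap_apply]
    · rw [RingHom.comp_apply, incl_root, evalAt_root, evalAt_root]
  exact RingHom.congr_fun this x

theorem incl_injective [NeZero n] : Function.Injective (incl F E n) := by
  intro x y h
  obtain ⟨f, rfl⟩ := toRn_surjective x
  obtain ⟨g, rfl⟩ := toRn_surjective y
  rw [incl_toRn, incl_toRn] at h
  congr 1
  funext j
  exact (algebraMap F E).injective (congrFun (toRn_injective h) j)

end Inclusion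

/-! ### The automorphisms `τ` -/

section Automorphisms

variable (F : Type*) {E : Type*} [Field F] [Fintype F] [Field E] [Algebra F E] {n : ℕ}

theorem frobenius_pow_apply (u : ℕ) (c : E) :
    (FiniteField.frobeniusAlgHom F E ^ u : E →ₐ[F] E) c = c ^ Fintype.card F ^ u := by
  rw [AlgHom.coe_pow, FiniteField.coe_frobeniusAlgHom, pow_iterate]

theorem tau_of (u : ℕ) (v : (ZMod n)ˣ) (c : E) :
    tau F u v (AdjoinRoot.of _ c) = AdjoinRoot.of _ (c ^ Fintype.card F ^ u) := by
  rw [tau, AdjoinRoot.lift_of, RingHom.comp_apply, RingHom.coe_coe, frobenius_pow_apply]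

theorem tau_root (u : ℕ) (v : (ZMod n)ˣ) :
    tau F u v (AdjoinRoot.root (X ^ n - 1 : E[X])) = AdjoinRoot.root _ ^ (v : ZMod n).val := by
  rw [tau, AdjoinRoot.lift_root]

theorem tau_incl (u : ℕ) (v : (ZMod n)ˣ) (y : Rn F n) :
    tau F u v (incl F E n y) = incl F E n (tau F 0 v y) := by
  have : (tau F u v).comp (incl F E n) = (incl F E n).comp (tau F 0 v) := by
    refine AdjoinRoot.ringHom_ext (RingHom.ext fun c => ?_) ?_
    · simp only [RingHom.comp_apply, tau_of, incl_of]
      rw [← map_pow, FiniteField.pow_card_pow, pow_zero, pow_one]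
    · rw [RingHom.comp_apply, RingHom.comp_apply, incl_root, tau_root, tau_root, map_pow, incl_root]
  exact RingHom.congr_fun this y

theorem tau_finrank [Finite E] (v : (ZMod n)ˣ) (x : Rn E n) :
    tau F (finrank F E) v x = tau F 0 v x := by
  have := Fintype.ofFinite E
  have hcard : Fintype.card F ^ finrank F E = Fintype.card E := (card_eq_pow_finrank).symm
  have : tau (E := E) F (finrank F E) v = tau F 0 v := by
    refine AdjoinRoot.ringHom_ext (RingHom.ext fun c => ?_) ?_
    · simp only [RingHom.comp_apply, tau_of]
      rw [hcard, FiniteField.pow_card, pow_zero, pow_one]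
    · rw [tau_root, tau_root]
  exact RingHom.congr_fun this x

variable [NeZero n]

theorem tau_tau (u u' : ℕ) (v v' : (ZMod n)ˣ) (x : Rn E n) :
    tau F u v (tau F u' v' x) = tau F (u + u') (v * v') x := by
  have : (tau F u v).comp (tau F u' v') = tau (E := E) F (u + u') (v * v') := by
    refine AdjoinRoot.ringHom_ext (RingHom.ext fun c => ?_) ?_
    · simp only [RingHom.comp_apply, tau_of]
      rw [← pow_mul, ← pow_add, add_comm]
    · rw [RingHom.comp_apply, tau_root, map_pow, tau_root, tau_root, ← pow_mul]
      apply root_pow_congr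
      simp
  exact RingHom.congr_fun this x

theorem tau_zero_one (x : Rn E n) : tau F 0 1 x = x := by
  have : tau (E := E) (n := n) F 0 1 = RingHom.id _ := by
    refine AdjoinRoot.ringHom_ext (RingHom.ext fun c => ?_) ?_
    · simp only [RingHom.comp_apply, tau_of]
      simp
    · rw [tau_root, RingHom.id_apply]
      conv_rhs => rw [← pow_one (AdjoinRoot.root _)]
      apply root_pow_congr
      simp
  exact RingHom.congr_fun this x

theorem tau_neg_neg (u : ℕ) (x : Rn E n) : tau F u (-1) (tau F u (-1) x) = tau F (u + u) 1 x := by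
  rw [tau_tau, neg_mul_neg, one_mul]

theorem tau_neg_involutive (x : Rn E n) : tau F 0 (-1) (tau F 0 (-1) x) = x := by
  rw [tau_neg_neg, tau_zero_one]

theorem evalAt_tau {L : Type*} [Field L] [Algebra E L] {η : L} (hη : IsPrimitiveRoot η n)
    (i : ZMod n) (v : (ZMod n)ˣ) (x : Rn E n) :
    evalAt E hη i (tau F 0 v x) = evalAt E hη (i * v) x := by
  have : (evalAt E hη i).comp (tau F 0 v) = evalAt E hη (i * v) := by
    refine AdjoinRoot.ringHom_ext (RingHom.ext fun c => ?_) ?_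
    · simp only [RingHom.comp_apply, tau_of, evalAt_of]
      rw [pow_zero, pow_one]
    · rw [RingHom.comp_apply, tau_root, map_pow, evalAt_root, evalAt_root, ← pow_val_mul hη,
        ZMod.natCast_zmod_val]
  exact RingHom.congr_fun this x

theorem tau_one_toRn (u : ℕ) (a : Fin n → E) :
    tau F u 1 (toRn a) = toRn (fun j => a j ^ Fintype.card F ^ u) := by
  rw [toRn_eq_sum, toRn_eq_sum, map_sum]
  refine Finset.sum_congr rfl fun j _ => ?_
  rw [map_mul, map_pow, tau_of, tau_root, ← pow_mul]
  congr 1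
  apply root_pow_congr
  simp

end Automorphisms

/-! ### The trace -/

section Trace

variable (F : Type*) {E : Type*} [Field F] [Fintype F] [Field E] [Algebra F E] {n : ℕ}

/-- The trace `∑_{w < t} τ_{q ^ w, 1}` of `E[X] / ⟨X ^ n - 1⟩` over `F[X] / ⟨X ^ n - 1⟩`, with
values in the larger ring. -/
noncomputable def trRn (x : Rn E n) : Rn E n := ∑ w ∈ Finset.range (finrank F E), tau F w 1 x

theorem trRn_add (x y : Rn E n) : trRn F (x + y) = trRn F x + trRn F y := by
  simp [trRn, Finset.sum_add_distrib]

theorem trRn_sub (x y : Rn E n) : trRn F (x - y) = trRn F x - trRn F y := by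
  simp [trRn, Finset.sum_sub_distrib]

theorem trRn_one : trRn F (1 : Rn E n) = (finrank F E : Rn E n) := by
  simp [trRn]

variable [NeZero n]

theorem trRn_incl_mul (y : Rn F n) (x : Rn E n) :
    trRn F (incl F E n y * x) = incl F E n y * trRn F x := by
  rw [trRn, trRn, Finset.mul_sum]
  refine Finset.sum_congr rfl fun w _ => ?_
  rw [map_mul, tau_incl]
  congr 2
  exact tau_zero_one F y

theorem tau_neg_trRn (x : Rn E n) : tau F 0 (-1) (trRn F x) = trRn F (tau F 0 (-1) x) := by
  rw [trRn, trRn, map_sum]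
  refine Finset.sum_congr rfl fun w _ => ?_
  rw [tau_tau, tau_tau, mul_comm, add_comm]

variable [Finite E]

theorem trRn_toRn (a : Fin n → E) :
    trRn F (toRn a) = incl F E n (toRn fun j => Algebra.trace F E (a j)) := by
  rw [trRn, incl_toRn, Finset.sum_congr rfl fun w _ => tau_one_toRn F w a, ← toRn_sum]
  congr 1
  funext j
  rw [Finset.sum_apply, FiniteField.algebraMap_trace_eq_sum_pow, Nat.card_eq_fintype_card]

theorem trRn_mem_range (x : Rn E n) : ∃ y, incl F E n y = trRn F x := by
  obtain ⟨a, rfl⟩ := toRn_surjective x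
  exact ⟨_, (trRn_toRn F a).symm⟩

theorem trRn_tau (u : ℕ) (x : Rn E n) : trRn F (tau F u 1 x) = trRn F x := by
  induction u with
  | zero => rw [tau_zero_one]
  | succ u ih =>
    rw [← ih, add_comm, ← one_mul (1 : (ZMod n)ˣ), ← tau_tau, one_mul]
    set y := tau F u 1 x
    have h : ∀ w, tau F w 1 (tau F 1 1 y) = tau F (w + 1) 1 y := fun w => by
      rw [tau_tau, one_mul]
    rw [trRn, trRn, Finset.sum_congr rfl fun w _ => h w]
    have h1 := Finset.sum_range_succ (fun w => tau F w 1 y) (finrank F E)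
    rw [Finset.sum_range_succ', tau_finrank] at h1
    exact add_right_cancel h1

theorem eq_zero_of_trRn_mul_eq_zero (y : Rn E n)
    (h : ∀ c : E, trRn F (AdjoinRoot.of _ c * y) = 0) : y = 0 := by
  obtain ⟨b, rfl⟩ := toRn_surjective y
  rw [← toRn_zero]
  congr 1
  funext j
  refine (traceForm_nondegenerate F E).2 _ fun c => ?_
  have h1 := h c
  rw [of_mul_toRn, trRn_toRn, ← map_zero (incl F E n)] at h1
  have h2 := incl_injective F h1
  rw [← toRn_zero] at h2
  exact congrFun (toRn_injective h2) j

end Trace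

/-! ### Cyclotomic cosets -/

section Coset

variable {n : ℕ} [NeZero n] {q : ℕ}

theorem mem_coset {ℓ m : ZMod n} : m ∈ coset q ℓ ↔ ∃ j : ℕ, m = ℓ * (q : ZMod n) ^ j := by
  simp [coset]

theorem self_mem_coset (ℓ : ZMod n) : ℓ ∈ coset q ℓ := mem_coset.2 ⟨0, by simp⟩

theorem neg_mem_coset {ℓ m : ZMod n} (h : coset q (-ℓ) = coset q ℓ) (hm : m ∈ coset q ℓ) :
    -m ∈ coset q ℓ := by
  rw [← h]
  obtain ⟨j, rfl⟩ := mem_coset.1 hm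
  exact mem_coset.2 ⟨j, by ring⟩

/-- The only `ℓ` with `2 ℓ = 0` are `0` and, for even `n`, the class of `n / 2`. -/
theorem two_mul_ne_zero_of_mem_fixedReps {ℓ : ZMod n} (hℓ : ℓ ∈ fixedReps n q) : 2 * ℓ ≠ 0 := by
  obtain ⟨-, h0, hhalf⟩ := hℓ
  intro h
  rw [← ZMod.natCast_zmod_val ℓ, ← Nat.cast_ofNat, ← Nat.cast_mul,
    ZMod.natCast_eq_zero_iff] at h
  have hlt := ZMod.val_lt ℓ
  obtain ⟨c, hc⟩ := h
  have hc2 : c < 2 := by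
    by_contra! hc2
    have := Nat.mul_le_mul_left n hc2
    omega
  interval_cases c
  · exact h0 (congrArg _ ((ZMod.val_eq_zero ℓ).1 (by omega)))
  · refine hhalf ⟨ℓ.val, by omega⟩ (congrArg _ ?_)
    rw [← ZMod.natCast_zmod_val ℓ]
    congr 1
    omega

/-- Negation is an involution without fixed points on a coset that it preserves. -/
theorem even_card_coset {ℓ : ZMod n} (hn : n.Coprime q) (hℓ : ℓ ∈ fixedReps n q) :
    Even (coset q ℓ).card := by
  have hunit : IsUnit (q : ZMod n) := (ZMod.unitOfCoprime q hn.symm).isUnit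
  have h := Finset.sum_involution (s := coset q ℓ) (f := fun _ => (1 : ZMod 2)) (fun m _ => -m)
    (fun _ _ => CharTwo.add_self_eq_zero 1) (fun m hm _ heq => ?_)
    (fun m hm => neg_mem_coset hℓ.1 hm) (fun m _ => neg_neg m)
  · rwa [Finset.sum_const, nsmul_one, ZMod.natCast_eq_zero_iff_even] at h
  · obtain ⟨j, rfl⟩ := mem_coset.1 hm
    apply two_mul_ne_zero_of_mem_fixedReps hℓ
    apply (hunit.pow j).mul_right_cancel
    linear_combination -heq

/-- Bézout: the residues `j + t r` with `j < gcd d t` exhaust the integers modulo `d`, so the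
cosets under `q ^ t` of the elements `ℓ q ^ j` cover the coset of `ℓ` under `q`. -/
theorem exists_mem_coset_pow {ℓ m : ZMod n} {d t : ℕ}
    (hd : ℓ * (q : ZMod n) ^ d = ℓ) (hd0 : 0 < d)
    (hm : m ∈ coset q ℓ) : ∃ j < Nat.gcd d t, m ∈ coset (q ^ t) (ℓ * (q : ZMod n) ^ j) := by
  obtain ⟨i, rfl⟩ := mem_coset.1 hm
  have hper : ∀ a b : ℕ, ℓ * (q : ZMod n) ^ (a + d * b) = ℓ * (q : ZMod n) ^ a := by
    intro a b
    induction b with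
    | zero => simp
    | succ b ih => rw [mul_add, mul_one, ← add_assoc, pow_add, mul_left_comm, hd, mul_comm, ih]
  refine ⟨i % Nat.gcd d t, Nat.mod_lt _ (Nat.gcd_pos_of_pos_left _ hd0), ?_⟩
  obtain ⟨b, hb⟩ : ∃ b : ℕ, (t * b) % d = Nat.gcd d t % d := by
    rcases (Nat.le_of_dvd hd0 (Nat.gcd_dvd_left d t)).lt_or_eq with hlt | heq
    · rw [Nat.gcd_comm] at hlt
      obtain ⟨b, -, hb⟩ := Nat.exists_mul_mod_eq_gcd hlt
      exact ⟨b, by rw [hb, Nat.gcd_comm d t, Nat.mod_eq_of_lt hlt]⟩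
    · exact ⟨0, by rw [heq]; simp⟩
  rw [mem_coset]
  refine ⟨b * (i / Nat.gcd d t), ?_⟩
  have h1 : i % Nat.gcd d t + t * (b * (i / Nat.gcd d t)) ≡ i [MOD d] := by
    have h2 : t * b * (i / Nat.gcd d t) ≡ Nat.gcd d t * (i / Nat.gcd d t) [MOD d] :=
      Nat.ModEq.mul_right _ hb
    have h3 := (h2.add_left (i % Nat.gcd d t))
    rwa [Nat.mod_add_div, mul_assoc] at h3
  have h4 : ∀ a : ℕ, ℓ * (q : ZMod n) ^ a = ℓ * (q : ZMod n) ^ (a % d) := fun a => by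
    conv_lhs => rw [← Nat.mod_add_div a d, hper]
  rw [Nat.cast_pow, ← pow_mul, mul_assoc, ← pow_add, h4 i, h4 (_ + _), h1]

end Coset

/-! ### The idempotent of `𝒦` and the order of `𝒦` -/

section Field

variable (F : Type*) {L : Type*} [Field F] [Field L] [Algebra F L] {n : ℕ} [NeZero n]
  {η : L} (hη : IsPrimitiveRoot η n) (ℓ : ZMod n)

theorem e_mem : (KField.e F hη ℓ).val ∈ minIdeal F η ℓ := (KField.e F hη ℓ).2

theorem e_mul {x : Rn F n} (hx : x ∈ minIdeal F η ℓ) : (KField.e F hη ℓ).val * x = x :=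
  (minIdeal_field F hη ℓ).choose_spec.2.2.1 x hx

theorem KField.e_mul_val (x : KField F hη ℓ) : (KField.e F hη ℓ).val * x.val = x.val :=
  e_mul F hη ℓ x.2

theorem mem_minIdeal_iff {x : Rn F n} :
    x ∈ minIdeal F η ℓ ↔ (KField.e F hη ℓ).val * x = x :=
  ⟨e_mul F hη ℓ, fun h => h ▸ Ideal.mul_mem_right _ _ (e_mem F hη ℓ)⟩

variable {F} in
theorem KField.val_injective {x y : KField F hη ℓ} (h : x.val = y.val) : x = y := Subtype.ext h

theorem KField.val_one : (1 : KField F hη ℓ).val = (KField.e F hη ℓ).val := rfl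

variable [Fintype F]

open Classical in
theorem evalAt_e (i : ZMod n) : evalAt F hη i (KField.e F hη ℓ).val =
    if i ∈ coset (Fintype.card F) ℓ then 1 else 0 :=
  evalAt_idempotent hη ℓ (e_mem F hη ℓ) (fun _ => e_mul F hη ℓ) i

/-- Evaluation at `η ^ ℓ` embeds the field `𝒦`. -/
noncomputable def KField.evalHom : KField F hη ℓ →+* L where
  toFun x := evalAt F hη ℓ x.val
  map_one' := by rw [KField.val_one, evalAt_e, if_pos (self_mem_coset ℓ)]
  map_mul' x y := by rw [KField.val_mul, map_mul]
  map_zero' := map_zero (evalAt F hη ℓ)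
  map_add' x y := by rw [KField.val_add, map_add]

include hη in
theorem natDegree_cosetPoly : (cosetPoly F η ℓ).natDegree = (coset (Fintype.card F) ℓ).card := by
  rw [← natDegree_map (algebraMap F L), map_cosetPoly F hη, natDegree_finsetProd_X_sub_C_eq_card]

/-- `𝒦` is isomorphic to `F(η ^ ℓ)` through evaluation. -/
theorem card_KField : Nat.card (KField F hη ℓ) =
    Fintype.card F ^ (coset (Fintype.card F) ℓ).card := by
  have hint := isIntegral_eta F hη ℓ.val
  have hr : ∀ x, x ∈ Set.range (KField.evalHom F hη ℓ) ↔ x ∈ Algebra.adjoin F {η ^ ℓ.val} := by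
    intro x
    rw [Algebra.adjoin_singleton_eq_range_aeval]
    constructor
    · rintro ⟨y, rfl⟩
      obtain ⟨p, hp⟩ := AdjoinRoot.mk_surjective y.val
      refine ⟨p, ?_⟩
      change _ = evalAt F hη ℓ y.val
      rw [← hp, evalAt_mk]
      rfl
    · rintro ⟨p, rfl⟩
      refine ⟨⟨AdjoinRoot.mk _ p * (KField.e F hη ℓ).val,
        Ideal.mul_mem_left _ _ (e_mem F hη ℓ)⟩, ?_⟩
      change evalAt F hη ℓ (AdjoinRoot.mk _ p * (KField.e F hη ℓ).val) = aeval _ p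
      rw [map_mul, evalAt_mk, evalAt_e, if_pos (self_mem_coset ℓ), mul_one]
  let pb := Algebra.adjoin.powerBasis hint
  have := pb.finite
  rw [Nat.card_congr (Equiv.ofInjective _ (KField.evalHom F hη ℓ).injective),
    Nat.card_congr (Equiv.subtypeEquivRight hr)]
  change Nat.card (Algebra.adjoin F {η ^ ℓ.val}) = _
  rw [Module.natCard_eq_pow_finrank (K := F), pb.finrank, Nat.card_eq_fintype_card,
    ← natDegree_cosetPoly F hη]
  rfl

instance : Finite (KField F hη ℓ) := by
  refine Nat.finite_of_card_ne_zero ?_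
  rw [card_KField]
  exact pow_ne_zero _ Fintype.card_ne_zero

include hη in
/-- The element `η ^ ℓ` lies in a field with `q ^ d` elements. -/
theorem mul_pow_card_coset :
    ℓ * (Fintype.card F : ZMod n) ^ (coset (Fintype.card F) ℓ).card = ℓ := by
  have := Fintype.ofFinite (KField F hη ℓ)
  let x : KField F hη ℓ := ⟨AdjoinRoot.root _ * (KField.e F hη ℓ).val,
    Ideal.mul_mem_left _ _ (e_mem F hη ℓ)⟩
  have hx : KField.evalHom F hη ℓ x = η ^ ℓ.val := by
    change evalAt F hη ℓ (AdjoinRoot.root _ * (KField.e F hη ℓ).val) = _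
    rw [map_mul, evalAt_root, evalAt_e, if_pos (self_mem_coset ℓ), mul_one]
  have h := congrArg (KField.evalHom F hη ℓ) (FiniteField.pow_card x)
  rw [← Nat.card_eq_fintype_card, card_KField, map_pow, hx] at h
  apply pow_val_injective hη
  rw [← Nat.cast_pow, pow_val_mul hη, h]

end Field

/-! ### The idempotent of `𝒥` -/

section Space

variable (F E : Type*) {L : Type*} [Field F] [Fintype F] [Field E] [Algebra F E] [Field L]
  [Algebra F L] [Algebra E L] [IsScalarTower F E L] {n : ℕ} [NeZero n] {η : L}
  (hη : IsPrimitiveRoot η n) (ℓ : ZMod n)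

/-- With `e_j` the idempotent of the `j`-th minimal ideal, the product of all `1 - e_j` is `1`
modulo `𝒥`. It has the value `0` on the coset of `ℓ` and the value `1` elsewhere, so it is
`1 - e`. -/
theorem e_mem_JIdeal [FiniteDimensional F E] :
    incl F E n (KField.e F hη ℓ).val ∈ JIdeal F E η ℓ := by
  classical
  have := Module.finite_of_finite F (M := E)
  have := Fintype.ofFinite E
  set q := Fintype.card F with hq
  set d := (coset q ℓ).card with hd
  set t := finrank F E with ht
  have hcard : Fintype.card E = q ^ t := card_eq_pow_finrank
  let ej : ℕ → Rn E n := fun j => (KField.e E hη (ℓ * (q : ZMod n) ^ j)).val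
  have hprod : incl F E n (KField.e F hη ℓ).val
      = 1 - ∏ j ∈ Finset.range (Nat.gcd d t), (1 - ej j) := by
    refine ext_evalAt hη fun i => ?_
    rw [evalAt_incl, evalAt_e, map_sub, map_one, map_prod]
    split_ifs with hi
    · obtain ⟨j, hj, hmem⟩ := exists_mem_coset_pow (t := t)
        (mul_pow_card_coset F hη ℓ) (Finset.card_pos.2 ⟨ℓ, self_mem_coset ℓ⟩) hi
      rw [Finset.prod_eq_zero (Finset.mem_range.2 hj), sub_zero]
      rw [map_sub, map_one, evalAt_e, hcard, if_pos hmem, sub_self]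
    · rw [Finset.prod_eq_one, sub_self]
      intro j _
      rw [map_sub, map_one, evalAt_e, hcard, if_neg, sub_zero]
      intro hmem
      obtain ⟨r, rfl⟩ := mem_coset.1 hmem
      apply hi
      rw [Nat.cast_pow, ← pow_mul, mul_assoc, ← pow_add]
      exact mem_coset.2 ⟨_, rfl⟩
  rw [hprod, ← Ideal.Quotient.eq_zero_iff_mem, map_sub, map_one, map_prod, Finset.prod_eq_one,
    sub_self]
  intro j hj
  rw [map_sub, map_one, Ideal.Quotient.eq_zero_iff_mem.2, sub_zero]
  exact le_iSup₂ (f := fun j _ => minIdeal E η (ℓ * (q : ZMod n) ^ j)) j hj (e_mem E hη _)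

theorem mem_JIdeal_iff [FiniteDimensional F E] {x : Rn E n} :
    x ∈ JIdeal F E η ℓ ↔ incl F E n (KField.e F hη ℓ).val * x = x :=
  ⟨e_mul_J F E hη ℓ x, fun h => h ▸ Ideal.mul_mem_right _ _ (e_mem_JIdeal F E hη ℓ)⟩

end Space

/-! ### Trace forms through the trace of the ring -/

section Forms

variable (F : Type*) {E : Type*} [Field F] [Fintype F] [Field E] [Algebra F E] {n : ℕ}

/-- The additive map `β` for which `[a, b]_δ` is the trace of `a * β b`. -/
noncomputable def adj : TraceForm E → Rn E n → Rn E n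
  | .star, b => ∑ w ∈ Finset.Ico 1 (finrank F E), tau F w (-1) b
  | .ordinary, b => tau F 0 (-1) b
  | .hermitian γ, b => AdjoinRoot.of _ γ * tau F (finrank F E / 2) (-1) b

/-- The additive map `φ` of `E` for which `(a, b)_δ = ∑ j, Tr (a j * φ (b j))`. -/
noncomputable def coordAdj : TraceForm E → E → E
  | .star, c => ∑ w ∈ Finset.Ico 1 (finrank F E), c ^ Fintype.card F ^ w
  | .ordinary, c => c
  | .hermitian γ, c => γ * c ^ Fintype.card F ^ (finrank F E / 2)

theorem ringForm_eq (δ : TraceForm E) (a b : Rn E n) :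
    ringForm F δ a b = trRn F (a * adj F δ b) := by
  cases δ with
  | star => rfl
  | ordinary => rfl
  | hermitian γ =>
    simp only [ringForm, trRn, adj]
    refine Finset.sum_congr rfl fun w _ => ?_
    rw [mul_left_comm, mul_assoc]

theorem vecForm_eq (δ : TraceForm E) (a b : Fin n → E) :
    vecForm F δ a b = ∑ j, Algebra.trace F E (a j * coordAdj F δ (b j)) := by
  cases δ with
  | star => rfl
  | ordinary => rfl
  | hermitian γ =>
    simp only [vecForm, coordAdj]
    refine Finset.sum_congr rfl fun j _ => ?_
    rw [mul_left_comm, mul_assoc]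

theorem adj_add (δ : TraceForm E) (x y : Rn E n) : adj F δ (x + y) = adj F δ x + adj F δ y := by
  cases δ <;> simp [adj, Finset.sum_add_distrib, mul_add]

theorem adj_incl_mul (δ : TraceForm E) (y : Rn F n) (x : Rn E n) :
    adj F δ (incl F E n y * x) = incl F E n (tau F 0 (-1) y) * adj F δ x := by
  cases δ with
  | star => simp [adj, tau_incl, Finset.mul_sum]
  | ordinary => simp [adj, tau_incl]
  | hermitian γ =>
    simp only [adj, map_mul, tau_incl]
    ring

theorem ringForm_add_left (δ : TraceForm E) (a a' b : Rn E n) :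
    ringForm F δ (a + a') b = ringForm F δ a b + ringForm F δ a' b := by
  rw [ringForm_eq, ringForm_eq, ringForm_eq, add_mul, trRn_add]

theorem ringForm_add_right (δ : TraceForm E) (a b b' : Rn E n) :
    ringForm F δ a (b + b') = ringForm F δ a b + ringForm F δ a b' := by
  rw [ringForm_eq, ringForm_eq, ringForm_eq, adj_add, mul_add, trRn_add]

theorem eq_zero_of_of_mul_eq_zero {c : E} (hc : c ≠ 0) {x : Rn E n}
    (h : AdjoinRoot.of _ c * x = 0) : x = 0 := by
  have h1 := congrArg (fun z => AdjoinRoot.of _ c⁻¹ * z) h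
  simpa only [← mul_assoc, ← map_mul, inv_mul_cancel₀ hc, map_one, one_mul, mul_zero] using h1

variable [NeZero n]

theorem ringForm_incl_mul_left (δ : TraceForm E) (y : Rn F n) (a b : Rn E n) :
    ringForm F δ (incl F E n y * a) b = incl F E n y * ringForm F δ a b := by
  rw [ringForm_eq, ringForm_eq, mul_assoc, trRn_incl_mul]

theorem ringForm_incl_mul_right (δ : TraceForm E) (y : Rn F n) (a b : Rn E n) :
    ringForm F δ a (incl F E n y * b) = incl F E n (tau F 0 (-1) y) * ringForm F δ a b := by
  rw [ringForm_eq, ringForm_eq, adj_incl_mul, mul_left_comm, trRn_incl_mul]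

/-- For the form `∗` the sum misses only the term `w = 0` of the trace. -/
theorem adj_star [FiniteDimensional F E] (b : Rn E n) :
    adj F .star b = trRn F (tau F 0 (-1) b) - tau F 0 (-1) b := by
  rw [adj, trRn, Finset.range_eq_Ico, Finset.sum_eq_sum_Ico_succ_bot finrank_pos, tau_zero_one,
    add_sub_cancel_left]
  refine Finset.sum_congr rfl fun w _ => ?_
  rw [tau_tau, add_zero, one_mul]

/-- The product `a(X) b(X⁻¹)` has the correlations of `a` and `b` as coefficients. -/
theorem mul_tau_neg_toRn (a b : Fin n → E) :
    toRn a * tau F 0 (-1) (toRn b) = toRn (fun s => ∑ j, a (j + s) * b j) := by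
  have hr : (toRn fun s => ∑ j, a (j + s) * b j) = ∑ j, toRn fun s => a (j + s) * b j := by
    rw [← toRn_sum]
    congr 1
    funext s
    simp
  rw [hr, toRn_eq_sum b, map_sum, Finset.mul_sum]
  refine Finset.sum_congr rfl fun j _ => ?_
  rw [toRn_eq_sum, toRn_eq_sum, Finset.sum_mul, ← Equiv.sum_comp (Equiv.addLeft j)]
  refine Finset.sum_congr rfl fun s _ => ?_
  rw [map_mul (tau F 0 (-1)), tau_of, map_pow (tau F 0 (-1)), tau_root, pow_zero, pow_one, map_mul,
    Equiv.coe_addLeft, mul_mul_mul_comm, ← pow_mul, ← pow_add]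
  congr 1
  apply root_pow_congr
  simp [Fin.val_add]

theorem adj_toRn (δ : TraceForm E) (b : Fin n → E) :
    adj F δ (toRn b) = tau F 0 (-1) (toRn fun j => coordAdj F δ (b j)) := by
  have h : ∀ w, tau F w (-1) (toRn b) = tau F 0 (-1) (toRn fun j => b j ^ Fintype.card F ^ w) := by
    intro w
    rw [← tau_one_toRn, tau_tau, zero_add, mul_one]
  cases δ with
  | star =>
    simp only [adj, coordAdj]
    rw [Finset.sum_congr rfl fun w _ => h w, ← map_sum, ← toRn_sum]
    congr 2
    funext j
    rw [Finset.sum_apply]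
  | ordinary => rfl
  | hermitian γ =>
    simp only [adj, coordAdj]
    rw [h, ← of_mul_toRn, map_mul, tau_of, pow_zero, pow_one]

/-- The coefficients of `[a, b]_δ` are the products `(a, b')_δ` of `a` with the cyclic shifts `b'`
of `b`. -/
theorem ringForm_toRn [Finite E] (δ : TraceForm E) (a b : Fin n → E) :
    ringForm F δ (toRn a) (toRn b) =
      incl F E n (toRn fun s => vecForm F δ a fun j => b (j - s)) := by
  rw [ringForm_eq, adj_toRn, mul_tau_neg_toRn, trRn_toRn]
  congr 2
  funext s
  rw [vecForm_eq, map_sum]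
  exact Fintype.sum_equiv (Equiv.addRight s) _ _ fun j => by simp

variable {F} in
/-- As `t = 2 ^ a m` with `m` odd, `γ ↦ γ ^ (q ^ (t / 2))` is the `m`-th iterate of a map that
sends `γ` to `-γ`. -/
theorem pow_half_finrank {γ : E} (h : (TraceForm.hermitian γ).Admissible F)
    [FiniteDimensional F E] : γ ^ Fintype.card F ^ (finrank F E / 2) = -γ := by
  obtain ⟨heven, -, -, hγ⟩ := h
  set t := finrank F E
  have ht : 0 < t := finrank_pos
  set r := padicValNat 2 t with hr
  have hr1 : 1 ≤ r := one_le_padicValNat_of_dvd ht.ne' heven.two_dvd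
  obtain ⟨m, hm⟩ : 2 ^ r ∣ t := pow_padicValNat_dvd
  have hodd : Odd m := by
    rw [← Nat.not_even_iff_odd]
    rintro hme
    obtain ⟨c, rfl⟩ := hme.two_dvd
    apply pow_succ_padicValNat_not_dvd (p := 2) ht.ne'
    exact ⟨c, by rw [← hr, hm]; ring⟩
  have hhalf : t / 2 = 2 ^ (r - 1) * m := by
    obtain ⟨s, hs⟩ : ∃ s, r = s + 1 := ⟨r - 1, by omega⟩
    rw [hm, hs, pow_succ, Nat.add_sub_cancel, mul_right_comm, Nat.mul_div_cancel _ two_pos]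
  have hiter : ∀ i : ℕ, γ ^ Fintype.card F ^ (2 ^ (r - 1) * i) = (-1) ^ i * γ := by
    intro i
    induction i with
    | zero => simp
    | succ i ih =>
      rw [mul_add, mul_one, pow_add, pow_mul, ih, ← frobenius_pow_apply F, map_mul, map_pow,
        map_neg, map_one, frobenius_pow_apply, eq_neg_of_add_eq_zero_right hγ]
      ring
  rw [hhalf, hiter, hodd.neg_one_pow, neg_one_mul]

variable [Finite E]

theorem trRn_trRn_mul (x y : Rn E n) : trRn F (trRn F x * y) = trRn F x * trRn F y := by
  obtain ⟨z, hz⟩ := trRn_mem_range F x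
  rw [← hz, trRn_incl_mul]

/-- The forms `∗` and `0` are Hermitian with respect to `τ_{1,-1}`. -/
theorem ringForm_conj {δ : TraceForm E} (hδ : ∀ γ, δ ≠ .hermitian γ) (a b : Rn E n) :
    tau F 0 (-1) (ringForm F δ b a) = ringForm F δ a b := by
  rw [ringForm_eq, ringForm_eq, tau_neg_trRn, map_mul]
  cases δ with
  | star =>
    rw [adj_star, adj_star, map_sub, tau_neg_trRn, tau_neg_involutive, mul_sub, mul_sub, trRn_sub,
      trRn_sub, mul_comm, trRn_trRn_mul, mul_comm a, trRn_trRn_mul, mul_comm, mul_comm a]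
  | ordinary => rw [adj, adj, tau_neg_involutive, mul_comm]
  | hermitian γ => exact absurd rfl (hδ γ)

variable {F} in
/-- The form with parameter `γ` is skew-Hermitian: moving `τ_{q ^ (t / 2), 1}` through the trace
turns `γ` into `-γ`. -/
theorem ringForm_hermitian_conj {γ : E} (hγ : (TraceForm.hermitian γ).Admissible F)
    (a b : Rn E n) :
    tau F 0 (-1) (ringForm F (.hermitian γ) b a) = -ringForm F (.hermitian γ) a b := by
  have h2 : finrank F E / 2 + finrank F E / 2 = finrank F E := by
    obtain ⟨r, hr⟩ := hγ.1
    omega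
  have h3 : tau F (finrank F E / 2) 1 (tau F 0 (-1) (b * (AdjoinRoot.of _ γ *
      tau F (finrank F E / 2) (-1) a))) =
      -(a * (AdjoinRoot.of _ γ * tau F (finrank F E / 2) (-1) b)) := by
    rw [tau_tau, add_zero, one_mul, map_mul, map_mul, tau_of, pow_half_finrank hγ, map_neg,
      tau_neg_neg, h2, tau_finrank, tau_zero_one]
    ring
  rw [ringForm_eq, ringForm_eq, tau_neg_trRn, ← trRn_tau F (finrank F E / 2), adj, adj, h3,
    ← zero_sub, trRn_sub, trRn, Finset.sum_congr rfl fun w _ => map_zero _, Finset.sum_const_zero,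
    zero_sub]

/-- The map `β` is injective. -/
theorem eq_zero_of_adj_eq_zero {δ : TraceForm E} (hδ : δ.Admissible F) {b : Rn E n}
    (h : adj F δ b = 0) : b = 0 := by
  rw [← tau_neg_involutive F b]
  cases δ with
  | star =>
    rw [adj_star, sub_eq_zero] at h
    set c := tau F 0 (-1) b
    -- `c` equals its own trace, hence lies in the small ring, where the trace is multiplication
    -- by `t`; so `(t - 1) c = 0`.
    have h1 := trRn_trRn_mul F c 1
    rw [mul_one, h, h, trRn_one] at h1
    have h2 : AdjoinRoot.of (X ^ n - 1 : E[X]) ((finrank F E : E) - 1) * c = 0 := by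
      rw [map_sub, map_one, map_natCast]
      linear_combination -h1
    have h3 : (finrank F E : E) - 1 ≠ 0 := by
      intro h0
      apply hδ
      rw [← CharP.natCast_eq_natCast F (ringChar F)]
      apply (algebraMap F E).injective
      rw [map_natCast, Nat.cast_one, map_one, ← sub_eq_zero, h0]
    rw [eq_zero_of_of_mul_eq_zero h3 h2, map_zero]
  | ordinary =>
    rw [adj] at h
    rw [h, map_zero]
  | hermitian γ =>
    have h2 : finrank F E / 2 + finrank F E / 2 = finrank F E := by
      obtain ⟨r, hr⟩ := hδ.1
      omega
    have h3 := congrArg (tau F (finrank F E / 2) (-1)) (eq_zero_of_of_mul_eq_zero hδ.2.1 h)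
    rw [tau_neg_neg, h2, tau_finrank, tau_zero_one, map_zero] at h3
    rw [h3, map_zero, map_zero]

end Forms

/-! ### The involution of `𝒦` -/

section Conjugation

variable (F : Type*) {L : Type*} [Field F] [Fintype F] [Field L] [Algebra F L] {n : ℕ} [NeZero n]
  {η : L} (hη : IsPrimitiveRoot η n) {ℓ : ZMod n}

theorem tau_neg_e (hℓ : coset (Fintype.card F) (-ℓ) = coset (Fintype.card F) ℓ) :
    tau F 0 (-1) (KField.e F hη ℓ).val = (KField.e F hη ℓ).val := by
  classical
  refine ext_evalAt hη fun i => ?_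
  rw [evalAt_tau, evalAt_e, evalAt_e]
  have h : i * ((-1 : (ZMod n)ˣ) : ZMod n) ∈ coset (Fintype.card F) ℓ ↔
      i ∈ coset (Fintype.card F) ℓ := by
    rw [Units.val_neg, Units.val_one, mul_neg_one]
    exact ⟨fun h => neg_neg i ▸ neg_mem_coset hℓ h, neg_mem_coset hℓ⟩
  simp only [h]

/-- The automorphism of `𝒦` induced by `X ↦ X⁻¹`. -/
noncomputable def KField.conj (hℓ : coset (Fintype.card F) (-ℓ) = coset (Fintype.card F) ℓ) :
    KField F hη ℓ →+* KField F hη ℓ where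
  toFun x := ⟨tau F 0 (-1) x.val, by
    rw [mem_minIdeal_iff F hη ℓ, ← tau_neg_e F hη hℓ, ← map_mul, KField.e_mul_val]⟩
  map_one' := KField.val_injective hη ℓ (tau_neg_e F hη hℓ)
  map_mul' x y := KField.val_injective hη ℓ (map_mul (tau F 0 (-1)) x.val y.val)
  map_zero' := KField.val_injective hη ℓ (map_zero (tau F 0 (-1)))
  map_add' x y := KField.val_injective hη ℓ (map_add (tau F 0 (-1)) x.val y.val)

theorem KField.val_conj (hℓ : coset (Fintype.card F) (-ℓ) = coset (Fintype.card F) ℓ)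
    (x : KField F hη ℓ) : (KField.conj F hη hℓ x).val = tau F 0 (-1) x.val := rfl

theorem KField.conj_conj (hℓ : coset (Fintype.card F) (-ℓ) = coset (Fintype.card F) ℓ)
    (x : KField F hη ℓ) : KField.conj F hη hℓ (KField.conj F hη hℓ x) = x :=
  KField.val_injective hη ℓ (tau_neg_involutive F x.val)

/-- The values of `X` and `X⁻¹` at `η ^ ℓ` differ as `2 ℓ ≠ 0`. -/
theorem KField.conj_ne_id (hℓ : coset (Fintype.card F) (-ℓ) = coset (Fintype.card F) ℓ)
    (h2 : 2 * ℓ ≠ 0) : KField.conj F hη hℓ ≠ RingHom.id _ := by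
  intro h
  let x : KField F hη ℓ := ⟨AdjoinRoot.root _ * (KField.e F hη ℓ).val,
    Ideal.mul_mem_left _ _ (e_mem F hη ℓ)⟩
  have hx : tau F 0 (-1) (AdjoinRoot.root _ * (KField.e F hη ℓ).val) =
      AdjoinRoot.root _ * (KField.e F hη ℓ).val := congrArg KField.val (RingHom.congr_fun h x)
  rw [map_mul, tau_neg_e F hη hℓ] at hx
  have h1 := congrArg (evalAt F hη ℓ) hx
  rw [map_mul, map_mul, evalAt_tau, evalAt_root, evalAt_root, evalAt_e,
    if_pos (self_mem_coset ℓ), mul_one, mul_one] at h1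
  have h3 := pow_val_injective hη h1
  rw [Units.val_neg, Units.val_one, mul_neg_one] at h3
  apply h2
  linear_combination -h3

end Conjugation

/-! ### The dimension of `𝒥` -/

section Coordinates

variable {F E : Type*} [Field F] [Field E] [Algebra F E] {n : ℕ}

theorem of_mul_incl_toRn (c : E) (f : Fin n → F) :
    AdjoinRoot.of _ c * incl F E n (toRn f) = toRn (fun j => f j • c) := by
  rw [incl_toRn, of_mul_toRn]
  congr 1
  funext j
  rw [Algebra.smul_def, mul_comm]

end Coordinates

section Space

variable (F E : Type*) {L : Type*} [Field F] [Fintype F] [Field E] [Algebra F E] [Field L]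
  [Algebra F L] [Algebra E L] [IsScalarTower F E L] {n : ℕ} [NeZero n] {η : L}
  (hη : IsPrimitiveRoot η n) {ℓ : ZMod n}

variable {F E} in
theorem JSpace.val_injective {x y : JSpace F E hη ℓ} (h : x.val = y.val) : x = y := Subtype.ext h

variable {F E} in
theorem JSpace.val_sum {ι : Type*} (s : Finset ι) (f : ι → JSpace F E hη ℓ) :
    (∑ i ∈ s, f i).val = ∑ i ∈ s, (f i).val :=
  map_sum (Submodule.subtype (JIdeal F E η ℓ)) f s

theorem JSpace.e_mul_val (x : JSpace F E hη ℓ) :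
    incl F E n (KField.e F hη ℓ).val * x.val = x.val := e_mul_J F E hη ℓ x.val x.2

variable [FiniteDimensional F E]

/-- A basis `ω` of `E` over `F` gives the basis `ω i * e` of `𝒥` over `𝒦`. -/
theorem finrank_JSpace : finrank (KField F hη ℓ) (JSpace F E hη ℓ) = finrank F E := by
  let ω := finBasis F E
  let b : Fin (finrank F E) → JSpace F E hη ℓ := fun i =>
    ⟨AdjoinRoot.of _ (ω i) * incl F E n (KField.e F hη ℓ).val,
      Ideal.mul_mem_left _ _ (e_mem_JIdeal F E hη ℓ)⟩
  have hval : ∀ y : Fin (finrank F E) → KField F hη ℓ,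
      (Fintype.linearCombination (KField F hη ℓ) b y).val
        = ∑ i, AdjoinRoot.of _ (ω i) * incl F E n (y i).val := by
    intro y
    rw [Fintype.linearCombination_apply, JSpace.val_sum]
    refine Finset.sum_congr rfl fun i _ => ?_
    rw [JSpace.val_smul]
    change incl F E n (y i).val * (AdjoinRoot.of _ (ω i) * incl F E n (KField.e F hη ℓ).val) = _
    rw [mul_left_comm, ← map_mul, mul_comm (y i).val, KField.e_mul_val]
  have hbij : Function.Bijective (Fintype.linearCombination (KField F hη ℓ) b) := by
    constructor
    · rw [injective_iff_map_eq_zero]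
      intro y hy
      choose f hf using fun i => toRn_surjective (y i).val
      have h0 := hval y
      rw [hy, Finset.sum_congr rfl fun i _ => by rw [← hf i, of_mul_incl_toRn], ← toRn_sum] at h0
      have h1 := toRn_injective (toRn_zero.trans h0)
      funext i
      apply KField.val_injective
      change (y i).val = 0
      rw [← hf i, ← toRn_zero]
      congr 1
      funext j
      have h2 := congrFun h1 j
      rw [Finset.sum_apply] at h2
      exact Fintype.linearIndependent_iff.1 ω.linearIndependent (fun i => f i j) h2.symm i
    · intro x
      obtain ⟨a, ha⟩ := toRn_surjective x.val
      let f : Fin (finrank F E) → Fin n → F := fun i j => ω.repr (a j) i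
      refine ⟨fun i => ⟨(KField.e F hη ℓ).val * toRn (f i),
        Ideal.mul_mem_right _ _ (e_mem F hη ℓ)⟩, JSpace.val_injective hη ?_⟩
      refine (hval _).trans ?_
      have h1 : x.val = ∑ i, AdjoinRoot.of _ (ω i) * incl F E n (toRn (f i)) := by
        rw [Finset.sum_congr rfl fun i _ => of_mul_incl_toRn (ω i) (f i), ← toRn_sum, ← ha]
        congr 1
        funext j
        rw [Finset.sum_apply]
        exact (ω.sum_repr (a j)).symm
      rw [← JSpace.e_mul_val, h1, Finset.mul_sum]
      refine Finset.sum_congr rfl fun i _ => ?_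
      change _ * incl F E n ((KField.e F hη ℓ).val * toRn (f i)) = _
      rw [map_mul, mul_left_comm]
  rw [← (LinearEquiv.ofBijective _ hbij).finrank_eq, finrank_fin_fun]

end Space

/-! ### The sesquilinear form on `𝒥` -/

section Form

variable {F E L : Type*} [Field F] [Fintype F] [Field E] [Algebra F E] [Field L]
  [Algebra F L] [Algebra E L] [IsScalarTower F E L] {n : ℕ} [NeZero n] {η : L}
  (hη : IsPrimitiveRoot η n) {ℓ : ZMod n}

/-- The values of the form on `𝒥` come from the small ring, and `e` fixes them. -/
theorem exists_form_value [Finite E] (δ : TraceForm E) (a b : JSpace F E hη ℓ) :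
    ∃ z : KField F hη ℓ, incl F E n z.val = ringForm F δ a.val b.val := by
  obtain ⟨y, hy⟩ := trRn_mem_range F (a.val * adj F δ b.val)
  refine ⟨⟨(KField.e F hη ℓ).val * y, Ideal.mul_mem_right _ _ (e_mem F hη ℓ)⟩, ?_⟩
  change incl F E n ((KField.e F hη ℓ).val * y) = _
  rw [map_mul, hy, ← ringForm_eq, ← ringForm_incl_mul_left]
  congr 1
  exact JSpace.e_mul_val F E hη a

variable [Finite E] (hℓ : coset (Fintype.card F) (-ℓ) = coset (Fintype.card F) ℓ)

/-- The form `[·,·]_δ` on `𝒥` with values in `𝒦`. -/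
noncomputable def formJ (δ : TraceForm E) : JSpace F E hη ℓ →ₗ[KField F hη ℓ]
    JSpace F E hη ℓ →ₛₗ[KField.conj F hη hℓ] KField F hη ℓ :=
  LinearMap.mk₂'ₛₗ (RingHom.id _) (KField.conj F hη hℓ)
    (fun a b => (exists_form_value hη δ a b).choose)
    (fun a a' b => KField.val_injective hη ℓ (incl_injective F (by
      rw [KField.val_add, map_add, (exists_form_value hη δ _ _).choose_spec,
        (exists_form_value hη δ _ _).choose_spec, (exists_form_value hη δ _ _).choose_spec]
      exact ringForm_add_left F δ a.val a'.val b.val)))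
    (fun c a b => KField.val_injective hη ℓ (incl_injective F (by
      rw [RingHom.id_apply, smul_eq_mul, KField.val_mul, map_mul,
        (exists_form_value hη δ _ _).choose_spec, (exists_form_value hη δ _ _).choose_spec]
      exact ringForm_incl_mul_left F δ c.val a.val b.val)))
    (fun a b b' => KField.val_injective hη ℓ (incl_injective F (by
      rw [KField.val_add, map_add, (exists_form_value hη δ _ _).choose_spec,
        (exists_form_value hη δ _ _).choose_spec, (exists_form_value hη δ _ _).choose_spec]
      exact ringForm_add_right F δ a.val b.val b'.val)))
    (fun c a b => KField.val_injective hη ℓ (incl_injective F (by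
      rw [smul_eq_mul, KField.val_mul, map_mul, (exists_form_value hη δ _ _).choose_spec,
        (exists_form_value hη δ _ _).choose_spec]
      exact ringForm_incl_mul_right F δ c.val a.val b.val)))

theorem incl_formJ (δ : TraceForm E) (a b : JSpace F E hη ℓ) :
    incl F E n (formJ hη hℓ δ a b).val = ringForm F δ a.val b.val :=
  (exists_form_value hη δ a b).choose_spec

theorem formJ_eq_zero_iff (δ : TraceForm E) (a b : JSpace F E hη ℓ) :
    formJ hη hℓ δ a b = 0 ↔ ringForm F δ a.val b.val = 0 := by
  rw [← incl_formJ hη hℓ, map_eq_zero_iff _ (incl_injective F)]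
  exact ⟨fun h => congrArg KField.val h, fun h => KField.val_injective hη ℓ h⟩

variable [FiniteDimensional F E]

/-- Non-degeneracy in the second argument: the trace of `a * β b` is zero for all `a` only if
`β b = 0`. -/
theorem eq_zero_of_formJ_right {δ : TraceForm E} (hδ : δ.Admissible F) {b : JSpace F E hη ℓ}
    (h : ∀ a, formJ hη hℓ δ a b = 0) : b = 0 := by
  apply JSpace.val_injective
  refine eq_zero_of_adj_eq_zero F hδ (eq_zero_of_trRn_mul_eq_zero F _ fun c => ?_)
  have h1 := (formJ_eq_zero_iff hη hℓ δ _ b).1 (h ⟨AdjoinRoot.of _ c *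
    incl F E n (KField.e F hη ℓ).val, Ideal.mul_mem_left _ _ (e_mem_JIdeal F E hη ℓ)⟩)
  change ringForm F δ (AdjoinRoot.of _ c * incl F E n (KField.e F hη ℓ).val) b.val = 0 at h1
  rwa [mul_comm, ringForm_incl_mul_left, ← tau_neg_e F hη hℓ, ← ringForm_incl_mul_right,
    JSpace.e_mul_val, ringForm_eq] at h1

theorem isUnitaryForm_smul {δ : TraceForm E} (hδ : δ.Admissible F) (h2 : 2 * ℓ ≠ 0)
    {v : KField F hη ℓ} (hv : v ≠ 0)
    (hH : ∀ a b, v * formJ hη hℓ δ a b = KField.conj F hη hℓ (v * formJ hη hℓ δ b a)) :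
    IsUnitaryForm (v • formJ hη hℓ δ) := by
  refine ⟨KField.conj_conj F hη hℓ, KField.conj_ne_id F hη hℓ h2, hH, fun a ha => ?_⟩
  refine eq_zero_of_formJ_right hη hℓ hδ fun b => ?_
  have h1 := hH b a
  rw [show v * formJ hη hℓ δ a b = 0 from ha b, map_zero] at h1
  exact (mul_eq_zero.1 h1).resolve_left hv

theorem isUnitaryForm_formJ {δ : TraceForm E} (hδ : δ.Admissible F) (h2 : 2 * ℓ ≠ 0)
    (hne : ∀ γ, δ ≠ .hermitian γ) : IsUnitaryForm (formJ hη hℓ δ) := by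
  rw [← one_smul (KField F hη ℓ) (formJ hη hℓ δ)]
  refine isUnitaryForm_smul hη hℓ hδ h2 one_ne_zero fun a b => ?_
  rw [one_mul, one_mul]
  apply KField.val_injective
  apply incl_injective F (E := E)
  rw [KField.val_conj, ← tau_incl F 0, incl_formJ, incl_formJ, ringForm_conj F hne]

theorem exists_isUnitaryForm_smul {δ : TraceForm E} (hδ : δ.Admissible F) (h2 : 2 * ℓ ≠ 0) :
    ∃ v : KField F hη ℓ, v ≠ 0 ∧ IsUnitaryForm (v • formJ hη hℓ δ) := by
  by_cases hne : ∀ γ, δ ≠ .hermitian γ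
  · exact ⟨1, one_ne_zero, by rw [one_smul]; exact isUnitaryForm_formJ hη hℓ hδ h2 hne⟩
  · push Not at hne
    obtain ⟨γ, rfl⟩ := hne
    obtain ⟨v, hv0, hv⟩ := exists_conj_eq_neg (KField.conj_conj F hη hℓ)
      (KField.conj_ne_id F hη hℓ h2)
    refine ⟨v, hv0, isUnitaryForm_smul hη hℓ hδ h2 hv0 fun a b => ?_⟩
    have h1 : KField.conj F hη hℓ (formJ hη hℓ (.hermitian γ) b a)
        = -formJ hη hℓ (.hermitian γ) a b := by
      apply KField.val_injective
      apply incl_injective F (E := E)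
      rw [KField.val_conj, ← tau_incl F 0, incl_formJ, ringForm_hermitian_conj hδ,
        ← incl_formJ hη hℓ, ← map_neg]
      rfl
    rw [map_mul, hv, h1, neg_mul_neg]

end Form

/-! ### Dual codes of cyclic codes -/

section Duality

variable {F E : Type*} [Field F] [Field E] [Algebra F E] {n : ℕ} [NeZero n]

theorem root_mul_toRn (s : Fin n) (c : Fin n → E) :
    AdjoinRoot.root _ ^ (s : ℕ) * toRn c = toRn (fun j => c (j - s)) := by
  rw [toRn_eq_sum, toRn_eq_sum, Finset.mul_sum]
  refine Fintype.sum_equiv (Equiv.addRight s) _ _ fun j => ?_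
  rw [mul_left_comm, ← pow_add, Equiv.coe_addRight, add_sub_cancel_right]
  congr 1
  apply root_pow_congr
  simp [Fin.val_add, add_comm]

theorem IsCyclic.shift_mem {C : Submodule F (Fin n → E)} (hC : IsCyclic C) {c : Fin n → E}
    (hc : c ∈ C) (s : Fin n) : (fun j => c (j - s)) ∈ C := by
  have h : ∀ (m : ℕ) (hm : m < n), (fun j => c (j - ⟨m, hm⟩)) ∈ C := by
    intro m
    induction m with
    | zero =>
      intro hm
      have h0 : (⟨0, hm⟩ : Fin n) = 0 := rfl
      simpa [h0] using hc
    | succ m ih =>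
      intro hm
      have h1 : (⟨m + 1, hm⟩ : Fin n) = 1 + ⟨m, by omega⟩ := by
        apply Fin.ext
        simp [Fin.val_add, add_comm, Nat.mod_eq_of_lt hm]
      have h2 := hC _ (ih (by omega))
      simpa [h1, sub_sub] using h2
  exact h s s.2

/-- A cyclic code is stable under multiplication by `F[X] / ⟨X ^ n - 1⟩`. -/
theorem IsCyclic.exists_mul {C : Submodule F (Fin n → E)} (hC : IsCyclic C) {c : Fin n → E}
    (hc : c ∈ C) (y : Rn F n) : ∃ c' ∈ C, toRn c' = incl F E n y * toRn c := by
  obtain ⟨f, rfl⟩ := toRn_surjective y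
  refine ⟨∑ s, f s • fun j => c (j - s),
    C.sum_mem fun s _ => C.smul_mem _ (hC.shift_mem hc s), ?_⟩
  rw [incl_toRn, toRn_sum, toRn_eq_sum fun j => algebraMap F E (f j), Finset.sum_mul]
  refine Finset.sum_congr rfl fun s _ => ?_
  rw [mul_assoc, root_mul_toRn, of_mul_toRn]
  congr 1
  funext j
  exact Algebra.smul_def _ _

end Duality

section Duality

variable {F E L : Type*} [Field F] [Fintype F] [Field E] [Algebra F E] [Field L]
  [Algebra F L] [Algebra E L] [IsScalarTower F E L] {n : ℕ} [NeZero n] {η : L}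
  (hη : IsPrimitiveRoot η n) {ℓ : ZMod n} [FiniteDimensional F E] [Finite E]
  (hℓ : coset (Fintype.card F) (-ℓ) = coset (Fintype.card F) ℓ)

include hη hℓ in
/-- Projecting a codeword to `𝒥` with the idempotent `e = τ e` does not change its products with
elements of `𝒥`, and the projection stays in the cyclic code. -/
theorem mem_dualCode_iff (δ : TraceForm E) {C : Submodule F (Fin n → E)} (hC : IsCyclic C)
    {v : Fin n → E} (hv : toRn v ∈ JIdeal F E η ℓ) :
    v ∈ dualCode δ C ↔
      ∀ c ∈ C, toRn c ∈ JIdeal F E η ℓ → ringForm F δ (toRn v) (toRn c) = 0 := by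
  constructor
  · intro h c hc _
    rw [ringForm_toRn, ← map_zero (incl F E n), ← toRn_zero]
    congr 2
    funext s
    exact h _ (hC.shift_mem hc s)
  · intro h c hc
    obtain ⟨c', hc', heq⟩ := hC.exists_mul hc (KField.e F hη ℓ).val
    have h1 := h c' hc' (heq ▸ Ideal.mul_mem_right _ _ (e_mem_JIdeal F E hη ℓ))
    rw [heq, ringForm_incl_mul_right, tau_neg_e F hη hℓ, ← ringForm_incl_mul_left,
      (mem_JIdeal_iff F E hη ℓ).1 hv, ringForm_toRn, ← map_zero (incl F E n), ← toRn_zero] at h1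
    have h2 := congrFun (toRn_injective (incl_injective F h1)) 0
    simpa using h2

end Duality

end CyclicCode

theorem mainTheorem2 {F E L : Type*} [Field F] [Fintype F] [Field E] [Field L]
    [Algebra F E] [Algebra F L] [Algebra E L] [IsScalarTower F E L]
    (n : ℕ) [NeZero n] (hn : n.Coprime (Fintype.card F)) (ht : 2 ≤ Module.finrank F E)
    {η : L} (hη : IsPrimitiveRoot η n)
    (δ : TraceForm E) (hδ : δ.Admissible F)
    (ℓ : ZMod n) (hℓ : ℓ ∈ fixedReps n (Fintype.card F)) (q t d : ℕ)
    (hq : q = Fintype.card F) (htt : t = Module.finrank F E)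
    (hd : d = (coset (Fintype.card F) ℓ).card) :
    Even d ∧
    Nat.card (KField F hη ℓ) = q ^ d ∧
    Module.finrank (KField F hη ℓ) (JSpace F E hη ℓ) = t ∧
    (∃ (σ : KField F hη ℓ →+* KField F hη ℓ)
      (B : JSpace F E hη ℓ →ₗ[KField F hη ℓ] JSpace F E hη ℓ →ₛₗ[σ] KField F hη ℓ),
      (∀ x, (σ x).val = tau F 0 (-1) x.val) ∧
      (∀ a b, incl F E n (B a b).val = ringForm F δ a.val b.val) ∧
      (∃ v : KField F hη ℓ, v ≠ 0 ∧ IsUnitaryForm (v • B)) ∧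
      ((∀ γ, δ ≠ TraceForm.hermitian γ) → IsUnitaryForm B)) ∧
    (∀ C : Submodule F (Fin n → E), IsCyclic C → ∀ v : Fin n → E, toRn v ∈ JIdeal F E η ℓ →
      (v ∈ dualCode δ C ↔
        ∀ c ∈ C, toRn c ∈ JIdeal F E η ℓ → ringForm F δ (toRn v) (toRn c) = 0)) ∧
    ({C : Submodule (KField F hη ℓ) (JSpace F E hη ℓ) |
        (C : Set (JSpace F E hη ℓ)) ∩ orthComp δ C = {0}}.ncard : ℚ) =
      2 + ∑ k ∈ Finset.Icc 1 (t - 1), (q : ℚ) ^ (k * (t - k) * d / 2) *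
        ∏ j ∈ Finset.range k,
          (((q : ℚ) ^ ((t - j) * d / 2) - (-1) ^ (t - j)) /
            ((q : ℚ) ^ ((k - j) * d / 2) - (-1) ^ (k - j))) := by
  subst hq htt hd
  have hpos : 0 < finrank F E := by omega
  have : FiniteDimensional F E := Module.finite_of_finrank_pos hpos
  have : Finite E := Module.finite_of_finite F
  have heven := even_card_coset hn hℓ
  have hfin := finrank_JSpace F E hη (ℓ := ℓ)
  have : FiniteDimensional (KField F hη ℓ) (JSpace F E hη ℓ) :=
    Module.finite_of_finrank_pos (by rwa [hfin])
  have : Finite (JSpace F E hη ℓ) := Module.finite_of_finite (KField F hη ℓ)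
  have h2 := two_mul_ne_zero_of_mem_fixedReps hℓ
  obtain ⟨v, hv0, hv⟩ := exists_isUnitaryForm_smul hη hℓ.1 hδ h2
  refine ⟨heven, card_KField F hη ℓ, hfin,
    ⟨KField.conj F hη hℓ.1, formJ hη hℓ.1 δ, KField.val_conj F hη hℓ.1, incl_formJ hη hℓ.1 δ,
      ⟨v, hv0, hv⟩, isUnitaryForm_formJ hη hℓ.1 hδ h2⟩,
    fun C hC w hw => mem_dualCode_iff hη hℓ.1 δ hC hw, ?_⟩
  -- The unitary multiple `v • [·,·]` has the same orthogonality relation as `[·,·]`.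
  have hset : ∀ C : Submodule (KField F hη ℓ) (JSpace F E hη ℓ),
      (C : Set (JSpace F E hη ℓ)) ∩ orthComp δ C = {0} ↔
        NondegOn (v • formJ hη hℓ.1 δ) C := by
    intro C
    have horth : ∀ a, a ∈ orthComp δ C ↔ ∀ c ∈ C, (v • formJ hη hℓ.1 δ) a c = 0 := fun a =>
      forall₂_congr fun c _ => by
        rw [← formJ_eq_zero_iff hη hℓ.1]
        exact (mul_eq_zero_iff_left hv0).symm
    rw [Set.eq_singleton_iff_unique_mem]
    constructor
    · exact fun h a ha hac => h.2 a ⟨ha, (horth a).2 hac⟩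
    · exact fun h => ⟨⟨C.zero_mem, (horth 0).2 fun c _ => by rw [map_zero]; rfl⟩,
        fun a ha => h a ha.1 ((horth a).1 ha.2)⟩
  obtain ⟨r, hr⟩ := heven
  -- The fixed field of the involution has `q ^ (d / 2)` elements.
  have hcard : Nat.card (KField F hη ℓ) = (Fintype.card F ^ r) ^ 2 := by
    rw [card_KField, hr, ← pow_mul, mul_two]
  have hdiv : ∀ a : ℕ, a * (coset (Fintype.card F) ℓ).card / 2 = r * a := by
    intro a
    rw [hr, ← mul_two, ← mul_assoc, Nat.mul_div_cancel _ two_pos, mul_comm]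
  simp only [hset, hdiv]
  rw [← Nat.card_coe_set_eq]
  have htotal := card_nondeg_total hv hcard (by rwa [hfin])
  rw [hfin] at htotal
  push_cast at htotal
  simp only [← pow_mul] at htotal
  exact htotal
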